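/- Setting. Let $d\ge 1$ and let $m$ be Lebesgue measure on $\mathbb R^d$. Write $\|v\|_\infty=\max_i|v_i|$ for vectors and $\|A\|_\infty=\max_i\sum_j|A_{ij}|$ for matrices. Let $\Omega\subset[0,1]^d$ be open and let $T:\Omega\to\overline\Omega$ satisfy the following hypotheses. 0. $m(T^{-n}\partial\Omega)=0$ for every $n\ge 1$. 1. $\Omega=\bigcup_k\Omega_k$ for a countable collection of disjoint connected open sets $\Omega_k$. On each $\Omega_k$ the map $T$ is $C^2$ and injective, with $C^1$ inverse $T(\Omega_k)\to\Omega_k$. 2. For each $k$, $T|_{\Omega_k}$ and $(DT)^{-1}|_{\Omega_k}$ extend continuously to $\overline{\Omega_k}$. 3. For $x\in\mathbb R^d$, $j\in\{1,\dots,d\}$ and $y\in\mathbb R$, let $(x_{\neq j},y)$ be $x$ with its $j$-th coordinate replaced by $y$. Let $I_{k,\ell}(x_{\neq j})$ be the disjoint open intervals whose union is $\{y:(x_{\neq j},y)\in\Omega_k\}$. There are $\delta>0$ and $\lambda>1$ such that, for all $x\in[0,1]^d$ and all $j$, $$\sum_{(k,\ell):\,[x_j-\delta,x_j+\delta]\cap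 I_{k,\ell}(x_{\neq j})\ne\emptyset}\ \sup_{y\in I_{k,\ell}(x_{\neq j})}\big\|[(DT)^{-1}](x_{\neq j},y)\big\|_\infty\le\lambda^{-1}.$$ 4. Let $\partial^\varepsilon\Omega_k=\{x\in\Omega_k:\operatorname{dist}(x,\partial\Omega_k)<\varepsilon\}$. For each $j$, $$\lim_{\varepsilon\to0^+}\ \sup_{x_{\ne j}}\ \sum_k\int_0^1\big\|\partial_{x_j}[(DT)^{-1}](x_{\ne j},y)\big\|_\infty\,\mathbf 1_{\partial^\varepsilon\Omega_k}(x_{\ne j},y)\,dy=0.$$ 5. $(DT)_{kj}\,[(DT)^{-1}]_{ji}\in L^1(\Omega,m)$ for all $i,j,k\in\{1,\dots,d\}$. For $h\in L^1(\Omega,m)$ real-valued, extended by zero outside $\Omega$, put $$\|h\|_{BV}=\sup\Big\{\int_{\mathbb R^d}\mathbf 1_\Omega h\,\operatorname{div}\varphi\,dm\ :\ \varphi\in C^1(\mathbb R^d,\mathbb R^d)\text{ compactly supported},\ \sup_x\|\varphi(x)\|_\infty\le1\Big\},$$ and let $BV$ be the set of $h\in L^1(\Omega,m)$ with $\|h\|_{BV}<\infty$.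 The transfer operator is $$\mathcal Lh(x)=\sum_{y\in\Omega,\ Ty=x}|\det D_yT|^{-1}h(y),\qquad x\in\Omega.$$ Lemma. For every $h\in L^1(\Omega,m)$ the series defining $\mathcal Lh(x)$ converges absolutely for almost every $x\in\Omega$, and for every integer $n\ge0$, $\mathcal L^nh\in L^1(\Omega,m)$ with $$\|\mathcal L^nh\|_{L^1(\Omega,m)}\le\|h\|_{L^1(\Omega,m)}.$$ For every $\sigma\in(\lambda^{-1},1)$ there is $B>0$ such that, for all integers $n\ge0$ and all $h\in BV$, $\mathcal L^nh\in BV$ and $$\|\mathcal L^nh\|_{BV}\le\sigma^n\|h\|_{BV}+B\,\|h\|_{L^1(\Omega,m)}.$$ -/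

import Mathlib

open MeasureTheory Set Filter Topology

/-- The space `ℝ^d`, with the maximum norm `‖v‖ = max_i |v i|` and Lebesgue measure. -/
abbrev Rn (d : ℕ) : Type := Fin d → ℝ

noncomputable section

/-! ### Functions of bounded variation -/

/-- The divergence `∑ i, ∂_{x_i} φ_i`. -/
def divergence {d : ℕ} (φ : Rn d → Rn d) (x : Rn d) : ℝ :=
  ∑ i, fderiv ℝ φ x (Pi.single i 1) i

/-- `sup ∫ h div φ` over the compactly supported `C^1` vector fields `φ` on `ℝ^d` with
`sup_x max_i |φ_i(x)| ≤ 1`. -/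
def bvNormSpace {d : ℕ} (h : Rn d → ℝ) : ENNReal :=
  ⨆ φ ∈ {φ : Rn d → Rn d | ContDiff ℝ 1 φ ∧ HasCompactSupport φ ∧ ∀ x, ‖φ x‖ ≤ 1},
    ENNReal.ofReal (∫ x, h x * divergence φ x)

/-- The norm of `BV(Ω)`: the function is extended by zero outside `Ω`, and the test fields are not
required to vanish on the boundary of `Ω`. -/
def bvNorm {d : ℕ} (Ω : Set (Rn d)) (h : Rn d → ℝ) : ENNReal :=
  bvNormSpace (Ω.indicator h)

/-- `h ∈ L^1(Ω)`, extended by zero outside `Ω`, has bounded variation on `ℝ^d`. -/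
def MemBV {d : ℕ} (Ω : Set (Rn d)) (h : Rn d → ℝ) : Prop :=
  IntegrableOn h Ω ∧ bvNorm Ω h < ⊤

/-! ### The transfer operator -/

/-- The Jacobian matrix `DT`, with entries `(DT)_{ab} = ∂_{x_b} T_a`. -/
def jac {d : ℕ} (T : Rn d → Rn d) (x : Rn d) : Matrix (Fin d) (Fin d) ℝ :=
  LinearMap.toMatrix' (fderiv ℝ T x : Rn d →ₗ[ℝ] Rn d)

/-- The inverse matrix `(D_x T)⁻¹`. -/
def jacInv {d : ℕ} (T : Rn d → Rn d) (x : Rn d) : Matrix (Fin d) (Fin d) ℝ :=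
  (jac T x)⁻¹

/-- The term `|det D_y T|⁻¹ h(y)` contributed by a preimage `y ∈ Ω` of `x`. -/
def transferTerm {d : ℕ} (Ω : Set (Rn d)) (T : Rn d → Rn d) (h : Rn d → ℝ) (x : Rn d)
    (y : {y : Rn d // y ∈ Ω ∧ T y = x}) : ℝ :=
  |(jac T y.1).det|⁻¹ * h y.1

/-- The transfer operator of `T : Ω → closure Ω`: `(L h)(x) = ∑_{T y = x} |det D_y T|⁻¹ h(y)` for
`x ∈ Ω`, extended by zero outside `Ω`. -/
def transfer {d : ℕ} (Ω : Set (Rn d)) (T : Rn d → Rn d) (h : Rn d → ℝ) : Rn d → ℝ :=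
  Ω.indicator fun x => ∑' y : {y : Rn d // y ∈ Ω ∧ T y = x}, transferTerm Ω T h x y

/-! ### The class of maps -/

/-- The maximal absolute row sum `max_a ∑_b |A a b|`. -/
def rowSumNorm {d : ℕ} (A : Matrix (Fin d) (Fin d) ℝ) : ENNReal :=
  ⨆ a, ∑ b, ENNReal.ofReal |A a b|

/-- The matrix `∂_{x_j} [(DT)⁻¹]` at `z`, entry by entry. -/
def partialJacInv {d : ℕ} (T : Rn d → Rn d) (j : Fin d) (z : Rn d) :
    Matrix (Fin d) (Fin d) ℝ :=
  Matrix.of fun a b => deriv (fun t => jacInv T (Function.update z j t) a b) (z j)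

/-- The preimage of `A` under `T : Ω → closure Ω`. Only the values of `T` on `Ω` matter. -/
def preimageIn {d : ℕ} (Ω : Set (Rn d)) (T : Rn d → Rn d) (A : Set (Rn d)) : Set (Rn d) :=
  Ω ∩ T ⁻¹' A

/-- The set of `y` such that `x`, with the `j`-th coordinate replaced by `y`, lies in `U`. -/
def lineSlice {d : ℕ} (U : Set (Rn d)) (j : Fin d) (x : Rn d) : Set ℝ :=
  {y | Function.update x j y ∈ U}

/-- The maximal intervals of the slice of `U` by the line through `x` parallel to the `j`-th axis.
For an open `U` these are the disjoint open intervals whose union is the slice. -/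
def sliceIntervals {d : ℕ} (U : Set (Rn d)) (j : Fin d) (x : Rn d) : Set (Set ℝ) :=
  {I | ∃ y ∈ lineSlice U j x, I = connectedComponentIn (lineSlice U j x) y}

/-- The sum, over the pieces `P k` and the intervals `I` of the slice of `P k` by the line through
`x` parallel to the `j`-th axis that meet `[x_j - δ, x_j + δ]`, of the supremum of `‖(DT)⁻¹‖` over
`I`. -/
def contractionSum {d : ℕ} {ι : Type*} (P : ι → Set (Rn d)) (T : Rn d → Rn d) (δ : ℝ)
    (j : Fin d) (x : Rn d) : ENNReal :=
  ∑' k : ι, ∑' I : {I : Set ℝ // I ∈ sliceIntervals (P k) j x ∧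
      (Icc (x j - δ) (x j + δ) ∩ I).Nonempty},
    ⨆ y ∈ I.1, rowSumNorm (jacInv T (Function.update x j y))

/-- The boundary layer `{x ∈ U : dist(x, ∂U) < ε}`. -/
def boundaryLayer {d : ℕ} (U : Set (Rn d)) (ε : ℝ) : Set (Rn d) :=
  {x ∈ U | Metric.infDist x (frontier U) < ε}

/-- `T : Ω → closure Ω` is a piecewise `C^2` expanding map with pieces of smoothness `P k`, where
`Ω ⊆ [0,1]^d` is open. The derivative of `T` may be unbounded. -/
structure IsPiecewiseExpanding {d : ℕ} {ι : Type*} (Ω : Set (Rn d)) (P : ι → Set (Rn d))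
    (T : Rn d → Rn d) (δ lam : ℝ) : Prop where
  isOpen : IsOpen Ω
  subset_cube : Ω ⊆ Icc 0 1
  mapsTo : MapsTo T Ω (closure Ω)
  /-- Almost every orbit never hits the boundary of `Ω`. -/
  null_preimage : ∀ n : ℕ, 1 ≤ n → volume ((preimageIn Ω T)^[n] (frontier Ω)) = 0
  piece_isOpen : ∀ k, IsOpen (P k)
  piece_isConnected : ∀ k, IsConnected (P k)
  piece_disjoint : Pairwise fun k l => Disjoint (P k) (P l)
  iUnion_piece : ⋃ k, P k = Ω
  contDiffOn : ∀ k, ContDiffOn ℝ 2 T (P k)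
  /-- The restriction of `T` to each piece is injective and has a `C^1` inverse. -/
  inverse_contDiffOn : ∀ k, ∃ S : Rn d → Rn d, LeftInvOn S T (P k) ∧ ContDiffOn ℝ 1 S (T '' P k)
  /-- `T` and `(DT)⁻¹`, restricted to a piece, extend continuously to the closure of the piece. -/
  extend_map : ∀ k, ∃ g : Rn d → Rn d, ContinuousOn g (closure (P k)) ∧ EqOn g T (P k)
  extend_jacInv : ∀ k, ∃ g : Rn d → Matrix (Fin d) (Fin d) ℝ,
    ContinuousOn g (closure (P k)) ∧ EqOn g (jacInv T) (P k)
  δ_pos : 0 < δ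
  one_lt_lam : 1 < lam
  /-- Expansion, weighted by the local complexity of the partition along coordinate lines. -/
  contraction : ∀ x ∈ Icc (0 : Rn d) 1, ∀ j, contractionSum P T δ j x ≤ ENNReal.ofReal lam⁻¹
  /-- Uniform integrability of `∂_{x_j} [(DT)⁻¹]` along lines close to the boundaries. -/
  layer_tendsto : ∀ j, Tendsto
    (fun ε : ℝ => ⨆ x : Rn d, ∑' k, ∫⁻ y in Icc (0 : ℝ) 1,
      (boundaryLayer (P k) ε).indicator (fun z => rowSumNorm (partialJacInv T j z))
        (Function.update x j y))
    (𝓝[>] 0) (𝓝 0)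
  /-- The products `(DT)_{kj} [(DT)⁻¹]_{ji}` are integrable on `Ω`. -/
  integrable_prod : ∀ i j k, IntegrableOn (fun x => jac T x k j * jacInv T x j i) Ω

end

/-! ### Change of variables piece by piece, the `L^1` contraction and duality. -/

section PieceTransfer

variable {d : ℕ} {ι : Type*} {Ω : Set (Rn d)} {P : ι → Set (Rn d)} {T : Rn d → Rn d} {δ lam : ℝ}

/-! The inequality is proved by duality. Changing variables on each piece gives `∫ (L h) div φ = ∫_Ω
h (div φ ∘ T)` (`integral_transfer_mul`), so it is enough to write `div φ ∘ T` as the divergence of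
a field of size at most `σ` plus a bounded error.

Put `ψ_j = ∑ i, [(DT)⁻¹]_{ji} φ_i ∘ T`. On the pieces `∂_j ψ_j` splits into `distortion`, where the
derivative falls on `(DT)⁻¹`, and `transport`, and the transports sum over `j` to `div φ ∘ T`
(`sum_transport`). Two obstacles remain: `ψ` jumps between pieces, and the distortion may be
unbounded.

The jumps are removed line by line. On every interval of every slice in direction `j`, `ψ_j` is
continued past the endpoints by its boundary values, decaying linearly to zero over a length `δ`,
and all these continuations are added. At a given point only the intervals within `δ` contribute, so
the contraction hypothesis bounds the sum by `λ⁻¹`. The sum has no singular derivative; its only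
extra derivative consists of slopes of size at most `λ⁻¹ δ⁻¹` (`exists_glued_extension`).

Away from thin boundary layers the distortion is bounded by compactness (`exists_bound_off_layers`).
Inside them its integral along each line is at most `σ - λ⁻¹`, and subtracting its primitive
(`exists_line_primitive`) removes it at the price of enlarging the field from `λ⁻¹` to `σ`.

The resulting field is only bounded with bounded weak divergence. Mollification shows that it still
tests the variation (`integral_mul_weakDivergence_le`). This gives the one-step inequality, which
iterates because `L` contracts `L^1`. -/

theorem IsPiecewiseExpanding.piece_subset (hT : IsPiecewiseExpanding Ω P T δ lam) (k : ι) :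
    P k ⊆ Ω := by
  rw [← hT.iUnion_piece]
  exact subset_iUnion P k

theorem IsPiecewiseExpanding.contDiffAt (hT : IsPiecewiseExpanding Ω P T δ lam) {k : ι}
    {x : Rn d} (hx : x ∈ P k) : ContDiffAt ℝ 2 T x :=
  (hT.contDiffOn k).contDiffAt ((hT.piece_isOpen k).mem_nhds hx)

theorem IsPiecewiseExpanding.hasFDerivAt (hT : IsPiecewiseExpanding Ω P T δ lam) {k : ι}
    {x : Rn d} (hx : x ∈ P k) : HasFDerivAt T (fderiv ℝ T x) x :=
  ((hT.contDiffAt hx).differentiableAt (by norm_num)).hasFDerivAt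

theorem IsPiecewiseExpanding.injOn (hT : IsPiecewiseExpanding Ω P T δ lam) (k : ι) :
    InjOn T (P k) := by
  obtain ⟨S, hS, -⟩ := hT.inverse_contDiffOn k
  exact hS.injOn

/-- Differentiating `S ∘ T = id` makes the two determinants multiply to `1`. The image of the piece
is not known to be open here, so `S` is differentiated within it; the composite has a genuine
derivative because `P k` is open. -/
theorem IsPiecewiseExpanding.det_fderiv_ne_zero (hT : IsPiecewiseExpanding Ω P T δ lam) {k : ι}
    {x : Rn d} (hx : x ∈ P k) : (fderiv ℝ T x).det ≠ 0 := by
  obtain ⟨S, hS, hS'⟩ := hT.inverse_contDiffOn k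
  have h1 : HasFDerivWithinAt S (fderivWithin ℝ S (T '' P k) (T x)) (T '' P k) (T x) :=
    ((hS'.differentiableOn (by norm_num)) (T x) (mem_image_of_mem T hx)).hasFDerivWithinAt
  have h2 := (h1.comp x (hT.hasFDerivAt hx).hasFDerivWithinAt (mapsTo_image T (P k))).hasFDerivAt
    ((hT.piece_isOpen k).mem_nhds hx)
  have h3 : HasFDerivAt (S ∘ T) (ContinuousLinearMap.id ℝ (Rn d)) x := by
    refine (hasFDerivAt_id x).congr_of_eventuallyEq ?_
    filter_upwards [(hT.piece_isOpen k).mem_nhds hx] with y hy using hS hy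
  have h4 := h2.unique h3
  have h5 : (fderivWithin ℝ S (T '' P k) (T x)).det * (fderiv ℝ T x).det = 1 := by
    have := congrArg ContinuousLinearMap.det h4
    simpa [ContinuousLinearMap.det, ContinuousLinearMap.coe_comp, LinearMap.det_comp] using this
  exact right_ne_zero_of_mul_eq_one h5

theorem det_jac (T : Rn d → Rn d) (x : Rn d) : (jac T x).det = (fderiv ℝ T x).det := by
  rw [jac, LinearMap.det_toMatrix']

/-- The contribution of the piece `P k` to the transfer operator. -/
noncomputable def pieceTransfer (P : ι → Set (Rn d)) (T : Rn d → Rn d) (h : Rn d → ℝ) (k : ι) :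
    Rn d → ℝ :=
  (T '' P k).indicator fun x =>
    |(fderiv ℝ T (Function.invFunOn T (P k) x)).det|⁻¹ * h (Function.invFunOn T (P k) x)

theorem IsPiecewiseExpanding.pieceTransfer_apply (hT : IsPiecewiseExpanding Ω P T δ lam) {k : ι}
    {y : Rn d} (hy : y ∈ P k) (h : Rn d → ℝ) :
    pieceTransfer P T h k (T y) = |(fderiv ℝ T y).det|⁻¹ * h y := by
  rw [pieceTransfer, indicator_of_mem (mem_image_of_mem T hy),
    (hT.injOn k).leftInvOn_invFunOn hy]

theorem IsPiecewiseExpanding.det_mul_pieceTransfer (hT : IsPiecewiseExpanding Ω P T δ lam) {k : ι}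
    {y : Rn d} (hy : y ∈ P k) (h : Rn d → ℝ) :
    |(fderiv ℝ T y).det| * pieceTransfer P T h k (T y) = h y := by
  rw [hT.pieceTransfer_apply hy, mul_inv_cancel_left₀ (abs_ne_zero.2 (hT.det_fderiv_ne_zero hy))]

/-- The piece containing a preimage; this identifies the fibre over `x` with a set of pieces. -/
theorem IsPiecewiseExpanding.exists_pieceIndex (hT : IsPiecewiseExpanding Ω P T δ lam)
    (x : Rn d) : ∃ e : {y : Rn d // y ∈ Ω ∧ T y = x} → ι, Function.Injective e ∧
      (∀ y, y.1 ∈ P (e y)) ∧ ∀ k, x ∈ T '' P k → k ∈ range e := by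
  have h1 : ∀ y : {y : Rn d // y ∈ Ω ∧ T y = x}, ∃ k, y.1 ∈ P k := fun y =>
    mem_iUnion.1 (hT.iUnion_piece.symm ▸ y.2.1 : y.1 ∈ ⋃ k, P k)
  choose e he using h1
  refine ⟨e, fun y z hyz => ?_, he, ?_⟩
  · refine Subtype.ext (hT.injOn (e y) (he y) ?_ (y.2.2.trans z.2.2.symm))
    rw [hyz]
    exact he z
  · rintro k ⟨y, hy, rfl⟩
    refine ⟨⟨y, hT.piece_subset k hy, rfl⟩, ?_⟩
    by_contra hne
    exact (hT.piece_disjoint hne).le_bot ⟨he _, hy⟩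

/-- By injectivity on pieces, each piece holds at most one preimage. The fibre therefore embeds into
the index set, and pieces outside the range contribute zero. This replaces a sum over a varying
fibre by one over a fixed countable set. -/
theorem IsPiecewiseExpanding.transferTerm_reindex (hT : IsPiecewiseExpanding Ω P T δ lam)
    (h : Rn d → ℝ) (x : Rn d) :
    (Summable (transferTerm Ω T h x) ↔ Summable fun k => pieceTransfer P T h k x) ∧
      ∑' y, transferTerm Ω T h x y = ∑' k, pieceTransfer P T h k x := by
  obtain ⟨e, he, hmem, hrange⟩ := hT.exists_pieceIndex x
  have h0 : ∀ k, k ∉ range e → pieceTransfer P T h k x = 0 := fun k hk =>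
    indicator_of_notMem (fun hx => hk (hrange k hx)) _
  have h1 : transferTerm Ω T h x = (fun k => pieceTransfer P T h k x) ∘ e := by
    funext y
    have := hT.pieceTransfer_apply (hmem y) h
    rw [y.2.2] at this
    rw [Function.comp_apply, this, transferTerm, det_jac]
  rw [h1]
  exact ⟨he.summable_iff h0, he.tsum_eq fun k hk => by
    by_contra hk'
    exact hk (h0 k hk')⟩

theorem IsPiecewiseExpanding.integrable_pieceTransfer (hT : IsPiecewiseExpanding Ω P T δ lam)
    {h : Rn d → ℝ} (hh : IntegrableOn h Ω) (k : ι) : Integrable (pieceTransfer P T h k) := by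
  have hm : MeasurableSet (T '' P k) :=
    measurable_image_of_fderivWithin (hT.piece_isOpen k).measurableSet
      (fun x hx => (hT.hasFDerivAt hx).hasFDerivWithinAt) (hT.injOn k)
  have h1 : IntegrableOn (pieceTransfer P T h k) (T '' P k) := by
    rw [integrableOn_image_iff_integrableOn_abs_det_fderiv_smul volume
      (hT.piece_isOpen k).measurableSet
      (fun x hx => (hT.hasFDerivAt hx).hasFDerivWithinAt) (hT.injOn k)]
    exact (hh.mono_set (hT.piece_subset k)).congr_fun
      (fun y hy => (hT.det_mul_pieceTransfer hy h).symm) (hT.piece_isOpen k).measurableSet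
  exact (integrableOn_iff_integrable_of_support_subset support_indicator_subset).1 h1

/-- The weight in the transfer operator is exactly the inverse of the Jacobian produced by the
change of variables. -/
theorem IsPiecewiseExpanding.lintegral_pieceTransfer (hT : IsPiecewiseExpanding Ω P T δ lam)
    (h : Rn d → ℝ) (k : ι) :
    ∫⁻ x, ‖pieceTransfer P T h k x‖ₑ = ∫⁻ x in P k, ‖h x‖ₑ := by
  have hm : MeasurableSet (T '' P k) :=
    measurable_image_of_fderivWithin (hT.piece_isOpen k).measurableSet
      (fun x hx => (hT.hasFDerivAt hx).hasFDerivWithinAt) (hT.injOn k)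
  rw [← setLIntegral_eq_of_support_subset (s := T '' P k),
    lintegral_image_eq_lintegral_abs_det_fderiv_mul volume (hT.piece_isOpen k).measurableSet
      (fun x hx => (hT.hasFDerivAt hx).hasFDerivWithinAt) (hT.injOn k)]
  · refine setLIntegral_congr_fun (hT.piece_isOpen k).measurableSet fun y hy => ?_
    have := congrArg (fun r : ℝ => ‖r‖ₑ) (hT.det_mul_pieceTransfer hy h)
    simp only [enorm_mul] at this
    rw [← this, ← Real.enorm_of_nonneg (abs_nonneg _)]
  · intro x hx
    by_contra hx'
    exact hx (by simp [pieceTransfer, hx'])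

theorem IsPiecewiseExpanding.integral_pieceTransfer_mul (hT : IsPiecewiseExpanding Ω P T δ lam)
    (h u : Rn d → ℝ) (k : ι) :
    ∫ x, pieceTransfer P T h k x * u x = ∫ x in P k, h x * u (T x) := by
  have hm : MeasurableSet (T '' P k) :=
    measurable_image_of_fderivWithin (hT.piece_isOpen k).measurableSet
      (fun x hx => (hT.hasFDerivAt hx).hasFDerivWithinAt) (hT.injOn k)
  rw [← setIntegral_eq_integral_of_forall_compl_eq_zero (s := T '' P k),
    integral_image_eq_integral_abs_det_fderiv_smul volume (hT.piece_isOpen k).measurableSet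
      (fun x hx => (hT.hasFDerivAt hx).hasFDerivWithinAt) (hT.injOn k)]
  · refine setIntegral_congr_fun (hT.piece_isOpen k).measurableSet fun y hy => ?_
    simp only [smul_eq_mul, ← mul_assoc, hT.det_mul_pieceTransfer hy h]
  · intro x hx
    simp [pieceTransfer, hx]

/-- Points of `Ω` can only leave it through the frontier, whose preimage is null by the case `n = 1`
of the hypothesis on orbits. -/
theorem IsPiecewiseExpanding.ae_mapsTo (hT : IsPiecewiseExpanding Ω P T δ lam) :
    ∀ᵐ x ∂(volume.restrict Ω), T x ∈ Ω := by
  rw [ae_restrict_iff' hT.isOpen.measurableSet]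
  have h0 := hT.null_preimage 1 le_rfl
  rw [Function.iterate_one, preimageIn] at h0
  filter_upwards [compl_mem_ae_iff.2 h0] with x hx hxΩ
  by_contra h1
  refine hx ⟨hxΩ, hT.mapsTo hxΩ, ?_⟩
  rwa [hT.isOpen.interior_eq]

variable [Countable ι]

theorem IsPiecewiseExpanding.tsum_lintegral_pieceTransfer
    (hT : IsPiecewiseExpanding Ω P T δ lam) (h : Rn d → ℝ) :
    ∑' k, ∫⁻ x, ‖pieceTransfer P T h k x‖ₑ = ∫⁻ x in Ω, ‖h x‖ₑ := by
  rw [tsum_congr (hT.lintegral_pieceTransfer h), ← hT.iUnion_piece,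
    lintegral_iUnion (fun k => (hT.piece_isOpen k).measurableSet) hT.piece_disjoint]

theorem IsPiecewiseExpanding.ae_summable_pieceTransfer
    (hT : IsPiecewiseExpanding Ω P T δ lam) {h : Rn d → ℝ} (hh : IntegrableOn h Ω) :
    ∀ᵐ x, Summable fun k => pieceTransfer P T h k x := by
  have h1 : ∫⁻ x, ∑' k, ‖pieceTransfer P T h k x‖ₑ ≠ ⊤ := by
    rw [lintegral_tsum fun k => (hT.integrable_pieceTransfer hh k).1.enorm,
      hT.tsum_lintegral_pieceTransfer]
    exact hh.2.ne
  filter_upwards [ae_lt_top' (AEMeasurable.tsum fun k =>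
    (hT.integrable_pieceTransfer hh k).1.enorm) h1] with x hx
  exact (ENNReal.tsum_coe_ne_top_iff_summable_coe.1 hx.ne).of_norm

theorem IsPiecewiseExpanding.lintegral_transfer_le (hT : IsPiecewiseExpanding Ω P T δ lam)
    {h : Rn d → ℝ} (hh : IntegrableOn h Ω) :
    ∫⁻ x in Ω, ‖transfer Ω T h x‖ₑ ≤ ∫⁻ x in Ω, ‖h x‖ₑ := by
  rw [← hT.tsum_lintegral_pieceTransfer h,
    ← lintegral_tsum fun k => (hT.integrable_pieceTransfer hh k).1.enorm]
  refine (setLIntegral_le_lintegral _ _).trans (lintegral_mono_ae ?_)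
  filter_upwards with x
  by_cases hx : x ∈ Ω
  · rw [transfer, indicator_of_mem hx, (hT.transferTerm_reindex h x).2]
    exact enorm_tsum_le_tsum_enorm
  · simp [transfer, hx]

theorem IsPiecewiseExpanding.integrable_transfer (hT : IsPiecewiseExpanding Ω P T δ lam)
    {h : Rn d → ℝ} (hh : IntegrableOn h Ω) : Integrable (transfer Ω T h) := by
  have h1 : AEStronglyMeasurable (transfer Ω T h) := by
    refine AEStronglyMeasurable.indicator ?_ hT.isOpen.measurableSet
    refine AEMeasurable.aestronglyMeasurable ?_
    simp_rw [fun x => (hT.transferTerm_reindex h x).2]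
    exact AEMeasurable.tsum fun k => (hT.integrable_pieceTransfer hh k).aemeasurable
  refine (integrableOn_iff_integrable_of_support_subset
    (s := Ω) support_indicator_subset).1 ⟨h1.restrict, ?_⟩
  exact (hT.lintegral_transfer_le hh).trans_lt hh.2

/-- The duality between `L` and composition with `T`. Boundedness of `u` justifies exchanging the
sum over pieces with the integral. -/
theorem IsPiecewiseExpanding.integral_transfer_mul (hT : IsPiecewiseExpanding Ω P T δ lam)
    {h u : Rn d → ℝ} (hh : IntegrableOn h Ω) (hu : Measurable u) {C : ℝ} (hC : ∀ x, |u x| ≤ C) :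
    ∫ x, transfer Ω T h x * u x = ∫ x in Ω, h x * u (T x) := by
  -- `transfer` is cut off to `Ω` but the piece contributions are not. Cutting off `u` instead
  -- reconciles them, and costs nothing since almost every point of `Ω` is mapped into `Ω`.
  set v := Ω.indicator u with hv
  have hvm : Measurable v := hu.indicator hT.isOpen.measurableSet
  have hvC : ∀ x, |v x| ≤ C := fun x => by
    by_cases hx : x ∈ Ω
    · simpa [hv, hx] using hC x
    · simpa [hv, hx] using (abs_nonneg _).trans (hC x)
  have h1 : ∀ x, transfer Ω T h x * u x = ∑' k, pieceTransfer P T h k x * v x := fun x => by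
    by_cases hx : x ∈ Ω
    · rw [transfer, indicator_of_mem hx, (hT.transferTerm_reindex h x).2, tsum_mul_right, hv,
        indicator_of_mem hx]
    · simp [transfer, hx, hv]
  have h2 : ∀ᵐ x ∂(volume.restrict Ω), h x * u (T x) = h x * v (T x) := by
    filter_upwards [hT.ae_mapsTo] with x hx
    rw [hv, indicator_of_mem hx]
  have h3 : ∀ k, Integrable fun x => pieceTransfer P T h k x * v x := fun k =>
    (hT.integrable_pieceTransfer hh k).mul_bdd hvm.aestronglyMeasurable (c := C)
      (Eventually.of_forall hvC)
  have h4 : IntegrableOn (fun x => h x * v (T x)) Ω := by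
    have : AEMeasurable T (volume.restrict Ω) := by
      rw [← hT.iUnion_piece, aemeasurable_iUnion_iff]
      exact fun k => (hT.contDiffOn k).continuousOn.aemeasurable (hT.piece_isOpen k).measurableSet
    exact hh.mul_bdd (hvm.comp_aemeasurable this).aestronglyMeasurable (c := C)
      (Eventually.of_forall fun x => hvC _)
  rw [integral_congr_ae h2, integral_congr_ae (Eventually.of_forall h1), integral_tsum
    (fun k => (h3 k).1), tsum_congr fun k => hT.integral_pieceTransfer_mul h v k,
    ← hT.iUnion_piece, integral_iUnion (fun k => (hT.piece_isOpen k).measurableSet)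
    hT.piece_disjoint (by rwa [hT.iUnion_piece])]
  refine ne_top_of_le_ne_top (b := ENNReal.ofReal C * ∫⁻ x in Ω, ‖h x‖ₑ) 
    (ENNReal.mul_ne_top ENNReal.ofReal_ne_top hh.2.ne) ?_
  rw [← hT.tsum_lintegral_pieceTransfer, ← ENNReal.tsum_mul_left]
  refine ENNReal.tsum_le_tsum fun k => ?_
  rw [← lintegral_const_mul' _ _ ENNReal.ofReal_ne_top]
  refine lintegral_mono fun x => ?_
  rw [enorm_mul, mul_comm]
  gcongr
  rw [← ofReal_norm]
  exact ENNReal.ofReal_le_ofReal (hvC x)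

theorem IsPiecewiseExpanding.iterate_transfer (hT : IsPiecewiseExpanding Ω P T δ lam)
    {h : Rn d → ℝ} (hh : IntegrableOn h Ω) (n : ℕ) :
    IntegrableOn ((transfer Ω T)^[n] h) Ω ∧
      eLpNorm ((transfer Ω T)^[n] h) 1 (volume.restrict Ω) ≤ eLpNorm h 1 (volume.restrict Ω) := by
  induction n with
  | zero => exact ⟨hh, le_rfl⟩
  | succ n ih =>
    rw [Function.iterate_succ_apply']
    refine ⟨(hT.integrable_transfer ih.1).integrableOn, le_trans ?_ ih.2⟩
    rw [eLpNorm_one_eq_lintegral_enorm, eLpNorm_one_eq_lintegral_enorm]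
    exact hT.lintegral_transfer_le ih.1

end PieceTransfer

/-! ### Integration along coordinate lines. -/

section Fubini

theorem insertNth_eq_update {n : ℕ} (j : Fin (n + 1)) (t : ℝ) (y : Fin n → ℝ) :
    j.insertNth t y = Function.update (j.insertNth 0 y : Rn (n + 1)) j t := by
  rw [Fin.update_insertNth]

theorem lintegral_eq_lintegral_insertNth {n : ℕ} (j : Fin (n + 1)) {f : Rn (n + 1) → ENNReal}
    (hf : Measurable f) :
    ∫⁻ x, f x = ∫⁻ y : Fin n → ℝ, ∫⁻ t : ℝ,
      f (Function.update (j.insertNth 0 y : Rn (n + 1)) j t) := by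
  have h := (volume_preserving_piFinSuccAbove (fun _ : Fin (n + 1) => ℝ) j).symm
  rw [← h.lintegral_comp hf, Measure.volume_eq_prod,
    lintegral_prod_symm' (fun z => f ((MeasurableEquiv.piFinSuccAbove
      (fun _ : Fin (n + 1) => ℝ) j).symm z)) (hf.comp (MeasurableEquiv.measurable _))]
  simp only [← insertNth_eq_update]
  rfl

theorem integral_eq_integral_insertNth {n : ℕ} (j : Fin (n + 1)) {f : Rn (n + 1) → ℝ}
    (hf : Integrable f) :
    (∀ᵐ y : Fin n → ℝ, Integrable fun t : ℝ =>
      f (Function.update (j.insertNth 0 y : Rn (n + 1)) j t)) ∧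
    ∫ x, f x = ∫ y : Fin n → ℝ, ∫ t : ℝ,
      f (Function.update (j.insertNth 0 y : Rn (n + 1)) j t) := by
  have h := (volume_preserving_piFinSuccAbove (fun _ : Fin (n + 1) => ℝ) j).symm
  have hf' := (h.integrable_comp_emb (MeasurableEquiv.measurableEmbedding _)).2 hf
  simp only [← insertNth_eq_update]
  refine ⟨hf'.prod_left_ae, ?_⟩
  rw [← h.integral_comp (MeasurableEquiv.measurableEmbedding _), Measure.volume_eq_prod]
  exact integral_prod_symm _ hf'

/-- The auxiliary `k` selects the lines: by Fubini its restriction is integrable on almost every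
one, so the other lines need not be compared. -/
theorem integral_eq_of_lines {d : ℕ} (j : Fin d) {f g k : Rn d → ℝ} (hf : Integrable f)
    (hg : Integrable g) (hk : Integrable k)
    (h : ∀ x, Integrable (fun t => k (Function.update x j t)) →
      ∫ t, f (Function.update x j t) = ∫ t, g (Function.update x j t)) :
    ∫ x, f x = ∫ x, g x := by
  obtain ⟨n, rfl⟩ : ∃ n, d = n + 1 := ⟨d - 1, by have := j.2; omega⟩
  rw [(integral_eq_integral_insertNth j hf).2, (integral_eq_integral_insertNth j hg).2]
  refine integral_congr_ae ?_
  filter_upwards [(integral_eq_integral_insertNth j hk).1] with y hy using h _ hy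

/-- The transverse unit cube has volume one, so a bound on every line passes to the whole integral
with the same constant. -/
theorem lintegral_le_of_lines {d : ℕ} (j : Fin d) {f : Rn d → ENNReal} (hf : Measurable f)
    (hf0 : ∀ x ∉ Icc (0 : Rn d) 1, f x = 0) {C : ENNReal}
    (h : ∀ x, ∫⁻ t, f (Function.update x j t) ≤ C) : ∫⁻ x, f x ≤ C := by
  obtain ⟨n, rfl⟩ : ∃ n, d = n + 1 := ⟨d - 1, by have := j.2; omega⟩
  rw [lintegral_eq_lintegral_insertNth j hf]
  have h1 : volume (Icc (0 : Fin n → ℝ) 1) = 1 := by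
    rw [Real.volume_Icc_pi]
    simp
  calc _ ≤ ∫⁻ y : Fin n → ℝ, (Icc (0 : Fin n → ℝ) 1).indicator (fun _ => C) y := by
        refine lintegral_mono fun y => ?_
        by_cases hy : y ∈ Icc (0 : Fin n → ℝ) 1
        · rw [indicator_of_mem hy]
          exact h _
        · rw [indicator_of_notMem hy, nonpos_iff_eq_zero]
          refine (lintegral_congr fun t => ?_).trans lintegral_zero
          refine hf0 _ fun hx => hy ⟨fun i => ?_, fun i => ?_⟩
          · simpa using hx.1 (j.succAbove i)
          · simpa using hx.2 (j.succAbove i)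
    _ = C := by
        rw [lintegral_indicator measurableSet_Icc, setLIntegral_const, h1, mul_one]

end Fubini

/-! ### Weak partial derivatives and weak derivatives on lines. -/

section WeakPartial

variable {d : ℕ}

/-- `F'` is the weak partial derivative of `F` in the direction of the `j`-th axis. -/
def HasWeakPartial (j : Fin d) (F F' : Rn d → ℝ) : Prop :=
  ∀ η : Rn d → ℝ, ContDiff ℝ 1 η → HasCompactSupport η →
    ∫ x, F x * fderiv ℝ η x (Pi.single j 1) = -∫ x, F' x * η x

/-- `f'` is the weak derivative of `f` on the line. -/
def HasWeakDeriv (f f' : ℝ → ℝ) : Prop :=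
  ∀ η : ℝ → ℝ, ContDiff ℝ 1 η → HasCompactSupport η → ∫ t, f t * deriv η t = -∫ t, f' t * η t

theorem continuous_partial {η : Rn d → ℝ} (hη : ContDiff ℝ 1 η) (j : Fin d) :
    Continuous fun x => fderiv ℝ η x (Pi.single j 1) :=
  (hη.continuous_fderiv one_ne_zero).clm_apply continuous_const

theorem integrable_partial {η : Rn d → ℝ} (hη : ContDiff ℝ 1 η) (hc : HasCompactSupport η)
    (j : Fin d) : Integrable fun x => fderiv ℝ η x (Pi.single j 1) :=
  (continuous_partial hη j).integrable_of_hasCompactSupport (hc.fderiv_apply ℝ _)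

theorem exists_forall_abs_le {η : Rn d → ℝ} (hη : Continuous η) (hc : HasCompactSupport η) :
    ∃ C, 0 ≤ C ∧ ∀ x, |η x| ≤ C := by
  obtain ⟨C, hC⟩ := hc.exists_bound_of_continuous hη
  exact ⟨C, (norm_nonneg _).trans (hC 0), hC⟩

theorem hasCompactSupport_comp_update {η : Rn d → ℝ} (hc : HasCompactSupport η) (x : Rn d)
    (j : Fin d) : HasCompactSupport fun t => η (Function.update x j t) := by
  refine HasCompactSupport.intro (hc.isCompact.image (continuous_apply j)) fun t ht => ?_
  by_contra h
  exact ht ⟨_, subset_tsupport _ h, by simp⟩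

theorem hasDerivAt_comp_update {η : Rn d → ℝ} (hη : ContDiff ℝ 1 η) (x : Rn d) (j : Fin d)
    (t : ℝ) : HasDerivAt (fun t => η (Function.update x j t))
      (fderiv ℝ η (Function.update x j t) (Pi.single j 1)) t :=
  ((hη.differentiable one_ne_zero) _).hasFDerivAt.comp_hasDerivAt t (hasDerivAt_update x j t)

theorem contDiff_update' (x : Rn d) (j : Fin d) : ContDiff ℝ 1 (Function.update x j) :=
  contDiff_update 1 x j

/-- A test function restricts to a test function on each line, so Fubini assembles the
one-dimensional identities. -/
theorem HasWeakPartial.of_lines {j : Fin d} {F F' : Rn d → ℝ} (hF : Measurable F) {C : ℝ}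
    (hC : ∀ x, |F x| ≤ C) (hF' : Integrable F')
    (h : ∀ x, Integrable (fun t => F' (Function.update x j t)) →
      HasWeakDeriv (fun t => F (Function.update x j t)) fun t => F' (Function.update x j t)) :
    HasWeakPartial j F F' := by
  intro η hη hc
  obtain ⟨K, -, hK⟩ := exists_forall_abs_le hη.continuous hc
  rw [← integral_neg]
  refine integral_eq_of_lines j
    ((integrable_partial hη hc j).bdd_mul hF.aestronglyMeasurable (Eventually.of_forall hC))
    (hF'.mul_bdd hη.continuous.aestronglyMeasurable (Eventually.of_forall hK)).neg hF' ?_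
  intro x hx
  have := h x hx _ (hη.comp (contDiff_update' x j)) (hasCompactSupport_comp_update hc x j)
  simp only [Function.comp_def, (hasDerivAt_comp_update hη x j _).deriv] at this
  rw [integral_neg]
  exact this

theorem HasWeakPartial.sub {j : Fin d} {F G F' G' : Rn d → ℝ} (hF : HasWeakPartial j F F')
    (hG : HasWeakPartial j G G') {C : ℝ} (hFm : Measurable F) (hGm : Measurable G)
    (hFC : ∀ x, |F x| ≤ C) (hGC : ∀ x, |G x| ≤ C) (hFi : LocallyIntegrable F')
    (hGi : LocallyIntegrable G') :
    HasWeakPartial j (fun x => F x - G x) (fun x => F' x - G' x) := by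
  intro η hη hc
  simp only [sub_mul]
  rw [integral_sub ((integrable_partial hη hc j).bdd_mul hFm.aestronglyMeasurable
      (Eventually.of_forall hFC)) ((integrable_partial hη hc j).bdd_mul hGm.aestronglyMeasurable
      (Eventually.of_forall hGC)), hF η hη hc, hG η hη hc, integral_sub]
  · ring
  · simpa only [smul_eq_mul, mul_comm] using
      hFi.integrable_smul_right_of_hasCompactSupport hη.continuous hc
  · simpa only [smul_eq_mul, mul_comm] using
      hGi.integrable_smul_right_of_hasCompactSupport hη.continuous hc

/-- The two exchanges of sum and integral use different controls: a uniform bound on the functions,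
paired with the integrable `∂_j η`, and an `L^1` bound on the derivatives, paired with the bounded
`η`. -/
theorem HasWeakPartial.tsum {κ : Type*} [Countable κ] {j : Fin d} {F F' : κ → Rn d → ℝ}
    (h : ∀ i, HasWeakPartial j (F i) (F' i)) (hF : ∀ i, Measurable (F i))
    (hF' : ∀ i, Measurable (F' i)) {C : ENNReal} (hCtop : C ≠ ⊤)
    (hC : ∀ x, ∑' i, ‖F i x‖ₑ ≤ C) (hI : ∫⁻ x, ∑' i, ‖F' i x‖ₑ ≠ ⊤) :
    HasWeakPartial j (fun x => ∑' i, F i x) (fun x => ∑' i, F' i x) := by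
  intro η hη hc
  obtain ⟨K, -, hK⟩ := exists_forall_abs_le hη.continuous hc
  simp only [← tsum_mul_right]
  rw [integral_tsum, integral_tsum, ← tsum_neg]
  · exact tsum_congr fun i => h i η hη hc
  · exact fun i => (hF' i).aestronglyMeasurable.mul hη.continuous.aestronglyMeasurable
  · rw [← lintegral_tsum fun i => (by
      exact ((hF' i).mul hη.continuous.measurable).enorm.aemeasurable)]
    refine ne_top_of_le_ne_top (ENNReal.mul_ne_top hI (ENNReal.ofReal_ne_top (r := K))) ?_
    rw [← lintegral_mul_const' _ _ ENNReal.ofReal_ne_top]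
    refine lintegral_mono fun x => ?_
    simp only [enorm_mul]
    rw [ENNReal.tsum_mul_right]
    gcongr
    rw [← ofReal_norm]
    exact ENNReal.ofReal_le_ofReal (hK x)
  · exact fun i => (hF i).aestronglyMeasurable.mul (continuous_partial hη j).aestronglyMeasurable
  · rw [← lintegral_tsum fun i => (by
      exact ((hF i).mul (continuous_partial hη j).measurable).enorm.aemeasurable)]
    refine ne_top_of_le_ne_top (ENNReal.mul_ne_top hCtop (integrable_partial hη hc j).2.ne) ?_
    rw [← lintegral_const_mul' _ _ hCtop]
    refine lintegral_mono fun x => ?_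
    simp only [enorm_mul]
    rw [ENNReal.tsum_mul_right]
    gcongr
    exact hC x

/-- The primitive of an integrable function on the line. -/
theorem hasWeakDeriv_primitive {G : ℝ → ℝ} (hG : Integrable G) :
    HasWeakDeriv (fun s => ∫ t, (Iio s).indicator G t) G := by
  intro η hη hc
  have hη' : Integrable (deriv η) :=
    (hη.continuous_deriv le_rfl).integrable_of_hasCompactSupport hc.deriv
  have hi : Integrable (Function.uncurry fun s t => (Iio s).indicator G t * deriv η s)
      (volume.prod volume) := by
    have := (hη'.mul_prod hG).indicator
      (measurableSet_lt measurable_snd measurable_fst : MeasurableSet {p : ℝ × ℝ | p.2 < p.1})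
    refine this.congr (Eventually.of_forall fun p => ?_)
    by_cases hp : p.2 < p.1 <;> simp [Function.uncurry, indicator, hp, mul_comm]
  simp only [← integral_mul_const]
  -- After the swap the inner integral is that of `η'` over `(t, ∞)`, which is `-η t` by compact
  -- support.
  rw [integral_integral_swap hi, ← integral_neg]
  refine integral_congr_ae (Eventually.of_forall fun t => ?_)
  have h1 : ∀ s, (Iio s).indicator G t * deriv η s = G t * (Ioi t).indicator (deriv η) s := by
    intro s
    by_cases hs : t < s <;> simp [indicator, hs]
  simp only [h1]
  rw [integral_const_mul, integral_indicator measurableSet_Ioi, hc.integral_Ioi_deriv_eq hη]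
  ring

end WeakPartial

/-! ### Testing the variation with non-smooth fields. -/

section Mollify

open scoped Convolution

variable {d : ℕ}

theorem abs_convolution_le {ρ g : Rn d → ℝ} (hρ : ∀ x, 0 ≤ ρ x) (hρ1 : ∫ x, ρ x = 1)
    (hρi : Integrable ρ) {C : ℝ} (hg : ∀ x, |g x| ≤ C) (x : Rn d) :
    |(ρ ⋆[ContinuousLinearMap.lsmul ℝ ℝ] g) x| ≤ C := by
  rw [convolution_def, ← Real.norm_eq_abs]
  calc _ ≤ ∫ t, ρ t * C := by
        refine norm_integral_le_of_norm_le (hρi.mul_const C) (Eventually.of_forall fun t => ?_)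
        simp only [ContinuousLinearMap.lsmul_apply, smul_eq_mul, norm_mul, Real.norm_eq_abs,
          abs_of_nonneg (hρ t)]
        exact mul_le_mul_of_nonneg_left (hg _) (hρ t)
    _ = C := by rw [integral_mul_const, hρ1, one_mul]

theorem fderiv_convolution_apply {ρ g : Rn d → ℝ} (hρ : ContDiff ℝ 1 ρ)
    (hc : HasCompactSupport ρ) (hg : LocallyIntegrable g) (x v : Rn d) :
    fderiv ℝ (ρ ⋆[ContinuousLinearMap.lsmul ℝ ℝ] g) x v =
      -∫ y, g y * fderiv ℝ (fun y => ρ (x - y)) y v := by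
  rw [(hc.hasFDerivAt_convolution_left (ContinuousLinearMap.lsmul ℝ ℝ) hρ hg x).fderiv,
    convolution_eq_swap, ContinuousLinearMap.integral_apply, ← integral_neg]
  · refine integral_congr_ae (Eventually.of_forall fun y => ?_)
    have h1 : HasFDerivAt (fun y => ρ (x - y)) ((fderiv ℝ ρ (x - y)).comp
        (-ContinuousLinearMap.id ℝ (Rn d))) y :=
      ((hρ.differentiable one_ne_zero) _).hasFDerivAt.comp y ((hasFDerivAt_id y).const_sub x)
    simp [h1.fderiv, mul_comm]
  · have := (hc.fderiv ℝ).convolutionExists_left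
      ((ContinuousLinearMap.lsmul ℝ ℝ : ℝ →L[ℝ] ℝ →L[ℝ] ℝ).precompL (Rn d))
      (hρ.continuous_fderiv one_ne_zero) hg x
    exact this.integrable_swap

theorem convolution_eq_integral {ρ g : Rn d → ℝ} (x : Rn d) :
    (ρ ⋆[ContinuousLinearMap.lsmul ℝ ℝ] g) x = ∫ y, g y * ρ (x - y) := by
  rw [convolution_eq_swap]
  simp [mul_comm]

theorem locallyIntegrable_of_bdd {g : Rn d → ℝ} (hg : Measurable g) {C : ℝ}
    (hC : ∀ x, |g x| ≤ C) : LocallyIntegrable g :=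
  (locallyIntegrable_const C).mono hg.aestronglyMeasurable (Eventually.of_forall fun x => by
    simpa using (hC x).trans (le_abs_self C))

/-- The divergence of a mollified field whose weak divergence is `D`. -/
theorem sum_fderiv_convolution {ρ : Rn d → ℝ} (hρ : ContDiff ℝ 1 ρ) (hc : HasCompactSupport ρ)
    {Θ : Fin d → Rn d → ℝ} {D : Rn d → ℝ} (hΘm : ∀ j, Measurable (Θ j)) {C : ℝ}
    (hΘC : ∀ j x, |Θ j x| ≤ C)
    (hw : ∀ η : Rn d → ℝ, ContDiff ℝ 1 η → HasCompactSupport η →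
      ∑ j, ∫ x, Θ j x * fderiv ℝ η x (Pi.single j 1) = -∫ x, D x * η x) (x : Rn d) :
    ∑ j, fderiv ℝ (ρ ⋆[ContinuousLinearMap.lsmul ℝ ℝ] Θ j) x (Pi.single j 1) =
      (ρ ⋆[ContinuousLinearMap.lsmul ℝ ℝ] D) x := by
  -- The reflected kernel is itself a test function, so the weak identity for `Θ` applies to it at
  -- each fixed `x`.
  have h1 : ContDiff ℝ 1 fun y => ρ (x - y) := hρ.comp (contDiff_const.sub contDiff_id)
  have h2 : HasCompactSupport fun y => ρ (x - y) :=
    hc.comp_homeomorph (Homeomorph.subLeft x)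
  rw [convolution_eq_integral, ← neg_neg (∫ y, D y * ρ (x - y)), ← hw _ h1 h2,
    ← Finset.sum_neg_distrib]
  exact Finset.sum_congr rfl fun j _ =>
    fderiv_convolution_apply hρ hc (locallyIntegrable_of_bdd (hΘm j) (hΘC j)) x _

theorem divergence_pi {φ : Fin d → Rn d → ℝ} {x : Rn d} (h : ∀ j, DifferentiableAt ℝ (φ j) x) :
    divergence (fun x j => φ j x) x = ∑ j, fderiv ℝ (φ j) x (Pi.single j 1) := by
  refine Finset.sum_congr rfl fun j _ => ?_
  rw [fderiv_pi h]
  rfl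

/-- A smooth field that is bounded by `σ` tests the variation of a function supported in the
unit cube, without a condition on its support. -/
theorem integral_mul_sum_fderiv_le {h : Rn d → ℝ} (h0 : ∀ x ∉ Icc (0 : Rn d) 1, h x = 0) {σ : ℝ}
    (hσ : 0 < σ) {φ : Fin d → Rn d → ℝ} (hφ : ∀ j, ContDiff ℝ 1 (φ j))
    (hφσ : ∀ j x, |φ j x| ≤ σ) :
    ENNReal.ofReal (∫ x, h x * ∑ j, fderiv ℝ (φ j) x (Pi.single j 1)) ≤
      ENNReal.ofReal σ * bvNormSpace h := by
  -- The cutoff equals `1` on a ball of radius `2` around the origin, hence near every point of the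
  -- cube. It makes the support compact without changing the divergence where `h` lives or
  -- increasing the sup norm.
  let χ : ContDiffBump (0 : Rn d) := ⟨2, 3, by norm_num, by norm_num⟩
  let ψ : Fin d → Rn d → ℝ := fun j x => σ⁻¹ * (χ x * φ j x)
  have hψ : ∀ j, ContDiff ℝ 1 (ψ j) := fun j =>
    contDiff_const.mul (χ.contDiff.mul (hφ j))
  have h1 : ∫ x, h x * ∑ j, fderiv ℝ (φ j) x (Pi.single j 1) =
      σ * ∫ x, h x * divergence (fun x j => ψ j x) x := by
    rw [← integral_const_mul]
    refine integral_congr_ae (Eventually.of_forall fun x => ?_)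
    by_cases hx : x ∈ Icc (0 : Rn d) 1
    · have h2 : ∀ᶠ y in 𝓝 x, χ y = 1 := by
        have : x ∈ Metric.ball (0 : Rn d) 2 := by
          rw [mem_ball_zero_iff, pi_norm_lt_iff (by norm_num)]
          intro i
          rw [Real.norm_eq_abs, abs_lt]
          constructor
          · have := hx.1 i
            simp at this
            linarith
          · have := hx.2 i
            simp at this
            linarith
        filter_upwards [Metric.isOpen_ball.mem_nhds this] with y hy
        exact χ.one_of_mem_closedBall (Metric.ball_subset_closedBall hy)
      have h3 : ∀ j, fderiv ℝ (ψ j) x = σ⁻¹ • fderiv ℝ (φ j) x := fun j => by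
        have h4 : ψ j =ᶠ[𝓝 x] fun y => σ⁻¹ • φ j y := by
          filter_upwards [h2] with y hy
          simp [ψ, hy]
        rw [h4.fderiv_eq, fderiv_fun_const_smul ((hφ j).differentiable one_ne_zero x)]
      simp only [divergence_pi fun j => (hψ j).differentiable one_ne_zero x, h3]
      simp only [smul_apply, smul_eq_mul, ← Finset.mul_sum]
      field_simp
    · simp [h0 x hx]
  rw [h1, ENNReal.ofReal_mul hσ.le]
  gcongr
  refine le_iSup₂_of_le (fun x j => ψ j x) ⟨contDiff_pi.2 hψ, ?_, fun x => ?_⟩ le_rfl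
  · refine HasCompactSupport.intro χ.hasCompactSupport.isCompact fun x hx => ?_
    funext j
    simp [ψ, image_eq_zero_of_notMem_tsupport hx]
  · rw [pi_norm_le_iff_of_nonneg zero_le_one]
    intro j
    rw [Real.norm_eq_abs, abs_mul, abs_mul, abs_of_pos (inv_pos.2 hσ), abs_of_nonneg χ.nonneg,
      inv_mul_le_iff₀ hσ, mul_one]
    exact (mul_le_of_le_one_left (abs_nonneg _) χ.le_one).trans (hφσ j x)

/-- A bounded field with bounded weak divergence tests the variation. -/
theorem integral_mul_weakDivergence_le {h : Rn d → ℝ} (hi : Integrable h)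
    (h0 : ∀ x ∉ Icc (0 : Rn d) 1, h x = 0) {σ : ℝ} (hσ : 0 < σ) {Θ : Fin d → Rn d → ℝ}
    {D : Rn d → ℝ} (hΘm : ∀ j, Measurable (Θ j)) (hΘ : ∀ j x, |Θ j x| ≤ σ) (hDm : Measurable D)
    {C : ℝ} (hD : ∀ x, |D x| ≤ C)
    (hw : ∀ η : Rn d → ℝ, ContDiff ℝ 1 η → HasCompactSupport η →
      ∑ j, ∫ x, Θ j x * fderiv ℝ η x (Pi.single j 1) = -∫ x, D x * η x) :
    ENNReal.ofReal (∫ x, h x * D x) ≤ ENNReal.ofReal σ * bvNormSpace h := by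
  let ρ : ℕ → ContDiffBump (0 : Rn d) := fun n =>
    ⟨1 / (n + 1) / 2, 1 / (n + 1), by positivity, half_lt_self (by positivity)⟩
  let D' : ℕ → Rn d → ℝ := fun n =>
    (ρ n).normed volume ⋆[ContinuousLinearMap.lsmul ℝ ℝ] D
  have hDl := locallyIntegrable_of_bdd hDm hD
  have h1 : ∀ᵐ x, Tendsto (fun n => D' n x) atTop (𝓝 (D x)) :=
    ContDiffBump.ae_convolution_tendsto_right_of_locallyIntegrable (K := 2)
      tendsto_one_div_add_atTop_nhds_zero_nat
      (Eventually.of_forall fun n => by simp [ρ, mul_div_cancel₀]) hDl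
  have hDc : ∀ n, Continuous (D' n) := fun n =>
    (ρ n).hasCompactSupport_normed.continuous_convolution_left _ (ρ n).continuous_normed hDl
  -- Convolution with a probability density preserves the bound on `D`, so a multiple of `|h|`
  -- dominates and almost everywhere convergence is enough.
  have h2 : Tendsto (fun n => ∫ x, h x * D' n x) atTop (𝓝 (∫ x, h x * D x)) := by
    refine tendsto_integral_of_dominated_convergence (fun x => |h x| * C)
      (fun n => hi.1.mul (hDc n).aestronglyMeasurable) (hi.abs.mul_const C)
      (fun n => Eventually.of_forall fun x => ?_) (h1.mono fun x hx => hx.const_mul _)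
    rw [norm_mul]
    exact mul_le_mul_of_nonneg_left (abs_convolution_le (fun x => (ρ n).nonneg_normed (μ := volume) x)
      (ρ n).integral_normed (ρ n).integrable_normed hD x) (norm_nonneg _)
  refine le_of_tendsto (ENNReal.tendsto_ofReal h2) (Eventually.of_forall fun n => ?_)
  have h3 := fun x => sum_fderiv_convolution ((ρ n).contDiff_normed (μ := volume))
    (ρ n).hasCompactSupport_normed hΘm hΘ hw x
  simp only [D', ← h3]
  exact integral_mul_sum_fderiv_le h0 hσ
    (fun j => (ρ n).hasCompactSupport_normed.contDiff_convolution_left _ (ρ n).contDiff_normed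
      (locallyIntegrable_of_bdd (hΘm j) (hΘ j)))
    fun j x => abs_convolution_le (fun x => (ρ n).nonneg_normed (μ := volume) x)
      (ρ n).integral_normed
      (ρ n).integrable_normed (hΘ j) x

end Mollify

/-! ### Continuing a function on an interval with linear decay. -/

section LineExtension

/-- The point of `[a, b]` closest to `t`. -/
def clamp (a b t : ℝ) : ℝ := max a (min b t)

/-- A tent function that is `1` on `[a, b]` and `0` at distance `δ` from it. -/
noncomputable def tent (a b δ t : ℝ) : ℝ := max 0 (1 - |t - clamp a b t| / δ)

theorem clamp_mem {a b : ℝ} (hab : a ≤ b) (t : ℝ) : clamp a b t ∈ Icc a b :=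
  ⟨le_max_left _ _, max_le hab (min_le_left _ _)⟩

theorem clamp_of_mem {a b t : ℝ} (ht : t ∈ Icc a b) : clamp a b t = t := by
  rw [clamp, min_eq_right ht.2, max_eq_right ht.1]

theorem clamp_of_le {a b t : ℝ} (ht : t ≤ a) : clamp a b t = a := by
  rw [clamp, max_eq_left ((min_le_right _ _).trans ht)]

theorem clamp_of_ge {a b t : ℝ} (hab : a ≤ b) (ht : b ≤ t) : clamp a b t = b := by
  rw [clamp, min_eq_left ht, max_eq_right hab]

theorem continuous_clamp (a b : ℝ) : Continuous (clamp a b) := by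
  unfold clamp
  fun_prop

theorem tent_nonneg (a b δ t : ℝ) : 0 ≤ tent a b δ t := le_max_left _ _

theorem tent_le_one {a b δ t : ℝ} (hδ : 0 < δ) : tent a b δ t ≤ 1 :=
  max_le zero_le_one (by have := div_nonneg (abs_nonneg (t - clamp a b t)) hδ.le; linarith)

theorem continuous_tent (a b δ : ℝ) : Continuous (tent a b δ) := by
  unfold tent
  have := continuous_clamp a b
  fun_prop

theorem abs_sub_clamp_lt_of_tent_ne_zero {a b δ t : ℝ} (hδ : 0 < δ) (h : tent a b δ t ≠ 0) :
    |t - clamp a b t| < δ := by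
  by_contra! h1
  exact h (max_eq_left (by rw [sub_nonpos, one_le_div hδ]; exact h1))

theorem tent_of_mem {a b δ t : ℝ} (ht : t ∈ Icc a b) : tent a b δ t = 1 := by
  simp [tent, clamp_of_mem ht]

theorem tent_eq_zero {a b δ t : ℝ} (hab : a ≤ b) (hδ : 0 < δ) (ht : t ∉ Ioo (a - δ) (b + δ)) :
    tent a b δ t = 0 := by
  by_contra h
  have h1 := abs_lt.1 (abs_sub_clamp_lt_of_tent_ne_zero hδ h)
  have h2 := clamp_mem hab t
  exact ht ⟨by linarith [h2.1], by linarith [h2.2]⟩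

theorem tent_left {a b δ t : ℝ} (hδ : 0 < δ) (ht : t ∈ Ioo (a - δ) a) :
    tent a b δ t = 1 - (a - t) / δ := by
  rw [tent, clamp_of_le ht.2.le, abs_sub_comm, abs_of_pos (sub_pos.2 ht.2), max_eq_right]
  rw [sub_nonneg, div_le_one hδ]
  linarith [ht.1]

theorem tent_right {a b δ t : ℝ} (hab : a ≤ b) (hδ : 0 < δ) (ht : t ∈ Ioo b (b + δ)) :
    tent a b δ t = 1 - (t - b) / δ := by
  rw [tent, clamp_of_ge hab ht.1.le, abs_of_pos (sub_pos.2 ht.1), max_eq_right]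
  rw [sub_nonneg, div_le_one hδ]
  linarith [ht.2]

/-- The slopes of the continuous extension of a function on `[a, b]` that decays linearly to zero
outside `[a, b]`. -/
noncomputable def tailSlope (a b δ : ℝ) (g : ℝ → ℝ) (t : ℝ) : ℝ :=
  (Ioo (a - δ) a).indicator (fun t => g (clamp a b t) / δ) t -
    (Ioo b (b + δ)).indicator (fun t => g (clamp a b t) / δ) t

/-- The continuation is continuous and is differentiable off finitely many points, so no point
masses appear at `a` and `b`. The derivative `g'` may be unbounded near them; only its integrability
matters. -/
theorem hasWeakDeriv_mul_tent {a b δ : ℝ} (hab : a < b) (hδ : 0 < δ) {g g' : ℝ → ℝ}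
    (hg : ContinuousOn g (Icc a b)) (hg' : ∀ t ∈ Ioo a b, HasDerivAt g (g' t) t)
    (hi : Integrable fun t => (Ioo a b).indicator g' t + tailSlope a b δ g t) :
    HasWeakDeriv (fun t => g (clamp a b t) * tent a b δ t)
      (fun t => (Ioo a b).indicator g' t + tailSlope a b δ g t) := by
  intro η hη hc
  set f : ℝ → ℝ := fun t => g (clamp a b t) * tent a b δ t with hf
  set f' : ℝ → ℝ := fun t => (Ioo a b).indicator g' t + tailSlope a b δ g t with hf'
  have hfc : Continuous f :=
    (hg.comp_continuous (continuous_clamp a b) (clamp_mem hab.le)).mul (continuous_tent a b δ)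
  have hf0 : ∀ t, t ∉ Ioo (a - δ) (b + δ) → f t = 0 := fun t ht => by
    rw [hf]
    simp only
    rw [tent_eq_zero hab.le hδ ht, mul_zero]
  have hf'0 : ∀ t, t ∉ Ioo (a - δ) (b + δ) → f' t = 0 := fun t ht => by
    simp only [hf', tailSlope]
    rw [indicator_of_notMem, indicator_of_notMem, indicator_of_notMem]
    · simp
    · exact fun h => ht ⟨by linarith [h.1], h.2⟩
    · exact fun h => ht ⟨h.1, by linarith [h.2]⟩
    · exact fun h => ht ⟨by linarith [h.1], by linarith [h.2]⟩
  obtain ⟨K, -, hK⟩ : ∃ C, 0 ≤ C ∧ ∀ x, |η x| ≤ C := by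
    obtain ⟨C, hC⟩ := hc.exists_bound_of_continuous hη.continuous
    exact ⟨C, (norm_nonneg _).trans (hC 0), hC⟩
  have hi1 : Integrable fun t => f t * deriv η t :=
    (hfc.mul (hη.continuous_deriv le_rfl)).integrable_of_hasCompactSupport hc.deriv.mul_left
  have hi2 : Integrable fun t => f' t * η t :=
    hi.mul_bdd hη.continuous.aestronglyMeasurable (Eventually.of_forall hK)
  have hderiv : ∀ t ∈ Ioo (a - δ) (b + δ) \ {a, b}, HasDerivAt f (f' t) t := by
    rintro t ⟨ht, hne⟩
    simp only [mem_insert_iff, mem_singleton_iff, not_or] at hne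
    rcases lt_or_gt_of_ne hne.1 with h1 | h1
    · have hmem : t ∈ Ioo (a - δ) a := ⟨ht.1, h1⟩
      have h2 : f =ᶠ[𝓝 t] fun t => g a * (1 - (a - t) / δ) := by
        filter_upwards [Ioo_mem_nhds hmem.1 hmem.2] with s hs
        simp only [hf]
        rw [tent_left hδ hs, clamp_of_le hs.2.le]
      have h3 : f' t = g a / δ := by
        simp only [hf', tailSlope]
        rw [indicator_of_notMem (fun h => h1.not_gt h.1), indicator_of_mem hmem,
          indicator_of_notMem (fun h => (h1.trans hab).not_gt h.1), clamp_of_le h1.le]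
        ring
      rw [h3]
      refine HasDerivAt.congr_of_eventuallyEq ?_ h2
      have := ((((hasDerivAt_id t).const_sub a).div_const δ).const_sub 1).const_mul (g a)
      exact (by ring : g a * -(-1 / δ) = g a / δ) ▸ this
    rcases lt_or_gt_of_ne hne.2 with h4 | h4
    · have hmem : t ∈ Ioo a b := ⟨h1, h4⟩
      have h2 : f =ᶠ[𝓝 t] g := by
        filter_upwards [Ioo_mem_nhds hmem.1 hmem.2] with s hs
        simp only [hf]
        rw [tent_of_mem (Ioo_subset_Icc_self hs), clamp_of_mem (Ioo_subset_Icc_self hs), mul_one]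
      have h3 : f' t = g' t := by
        simp only [hf', tailSlope]
        rw [indicator_of_mem hmem, indicator_of_notMem (fun h => h1.not_gt h.2),
          indicator_of_notMem (fun h => h4.not_gt h.1)]
        ring
      rw [h3]
      exact (hg' t hmem).congr_of_eventuallyEq h2
    · have hmem : t ∈ Ioo b (b + δ) := ⟨h4, ht.2⟩
      have h2 : f =ᶠ[𝓝 t] fun t => g b * (1 - (t - b) / δ) := by
        filter_upwards [Ioo_mem_nhds hmem.1 hmem.2] with s hs
        simp only [hf]
        rw [tent_right hab.le hδ hs, clamp_of_ge hab.le hs.1.le]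
      have h3 : f' t = -(g b / δ) := by
        simp only [hf', tailSlope]
        rw [indicator_of_notMem (fun h => h4.not_gt h.2), indicator_of_notMem
          (fun h => h1.not_gt h.2), indicator_of_mem hmem, clamp_of_ge hab.le h4.le]
        ring
      rw [h3]
      refine HasDerivAt.congr_of_eventuallyEq ?_ h2
      have := ((((hasDerivAt_id t).sub_const b).div_const δ).const_sub 1).const_mul (g b)
      exact (by ring : g b * -(1 / δ) = -(g b / δ)) ▸ this
  have hle : a - δ ≤ b + δ := by linarith
  -- The kinks at `a` and `b` are the exceptional points. The kinks at `a - δ` and `b + δ` are the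
  -- ends of the interval of integration, where `f` vanishes.
  have key := integral_eq_of_hasDerivAt_off_countable_of_le (fun t => f t * η t)
    (fun t => f' t * η t + f t * deriv η t) hle (s := {a, b}) (by simp)
    (hfc.mul hη.continuous).continuousOn
    (fun t ht => (hderiv t ht).mul ((hη.differentiable one_ne_zero) t).hasDerivAt)
    (hi2.add hi1).intervalIntegrable
  rw [hf0 (b + δ) (fun h => lt_irrefl _ h.2), hf0 (a - δ) (fun h => lt_irrefl _ h.1),
    intervalIntegral.integral_of_le hle, setIntegral_eq_integral_of_forall_compl_eq_zero,
    integral_add hi2 hi1] at key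
  · linarith
  · intro t ht
    have ht' : t ∉ Ioo (a - δ) (b + δ) := fun h => ht ⟨h.1, h.2.le⟩
    rw [hf0 t ht', hf'0 t ht', zero_mul, zero_mul, add_zero]

end LineExtension

/-! ### Measurable enumeration of the intervals of a slice. -/

section Slices

variable {d : ℕ} {U : Set (Rn d)} {j : Fin d}

theorem lineSlice_update (U : Set (Rn d)) (j : Fin d) (x : Rn d) (t : ℝ) :
    lineSlice U j (Function.update x j t) = lineSlice U j x := by
  simp [lineSlice]

theorem isOpen_lineSlice (hU : IsOpen U) (j : Fin d) (x : Rn d) : IsOpen (lineSlice U j x) :=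
  hU.preimage (continuous_const.update j continuous_id)

theorem lineSlice_subset (hU : U ⊆ Icc 0 1) (j : Fin d) (x : Rn d) :
    lineSlice U j x ⊆ Icc 0 1 := fun t ht => by
  have := hU ht
  exact ⟨by simpa using this.1 j, by simpa using this.2 j⟩

/-- The maximal interval of the slice that contains `q`. -/
noncomputable def sliceComp (U : Set (Rn d)) (j : Fin d) (x : Rn d) (q : ℝ) : Set ℝ :=
  connectedComponentIn (lineSlice U j x) q

theorem sliceComp_update (U : Set (Rn d)) (j : Fin d) (x : Rn d) (t q : ℝ) :
    sliceComp U j (Function.update x j t) q = sliceComp U j x q := by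
  rw [sliceComp, lineSlice_update, sliceComp]

/-- On the line connected sets are intervals. Membership in a component thus becomes a condition on
a compact segment, which is stable under moving the line. -/
theorem mem_sliceComp {x : Rn d} {q r : ℝ} :
    r ∈ sliceComp U j x q ↔ uIcc q r ⊆ lineSlice U j x := by
  constructor
  · intro h
    have hq : q ∈ lineSlice U j x := by
      by_contra hq
      rw [sliceComp, connectedComponentIn_eq_empty hq] at h
      exact h
    exact ((isPreconnected_connectedComponentIn.ordConnected).uIcc_subset
      (mem_connectedComponentIn hq) h).trans (connectedComponentIn_subset _ _)
  · intro h
    exact isPreconnected_uIcc.subset_connectedComponentIn left_mem_uIcc h right_mem_uIcc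

/-- The tube lemma: a compact segment inside the open set `U` stays inside under small
displacements. -/
theorem isOpen_setOf_mem_sliceComp (hU : IsOpen U) (q r : ℝ) :
    IsOpen {x | r ∈ sliceComp U j x q} := by
  simp only [mem_sliceComp]
  rw [isOpen_iff_eventually]
  intro x hx
  refine isCompact_uIcc.eventually_forall_of_forall_eventually (x₀ := x)
    (P := fun x t => Function.update x j t ∈ U) fun t ht => ?_
  have h1 : Continuous fun p : Rn d × ℝ => Function.update p.1 j p.2 :=
    continuous_fst.update j continuous_snd
  exact h1.continuousAt.eventually (hU.mem_nhds (hx ht))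

noncomputable def sliceInf (U : Set (Rn d)) (j : Fin d) (q : ℝ) (x : Rn d) : ℝ :=
  sInf (sliceComp U j x q)

noncomputable def sliceSup (U : Set (Rn d)) (j : Fin d) (q : ℝ) (x : Rn d) : ℝ :=
  sSup (sliceComp U j x q)

theorem sliceComp_subset {x : Rn d} {q : ℝ} : sliceComp U j x q ⊆ lineSlice U j x :=
  connectedComponentIn_subset _ _

theorem bddBelow_sliceComp (hU1 : U ⊆ Icc 0 1) (x : Rn d) (q : ℝ) :
    BddBelow (sliceComp U j x q) :=
  bddBelow_Icc.mono (sliceComp_subset.trans (lineSlice_subset hU1 j x))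

theorem bddAbove_sliceComp (hU1 : U ⊆ Icc 0 1) (x : Rn d) (q : ℝ) :
    BddAbove (sliceComp U j x q) :=
  bddAbove_Icc.mono (sliceComp_subset.trans (lineSlice_subset hU1 j x))

theorem sliceComp_eq_Ioo (hU : IsOpen U) (hU1 : U ⊆ Icc 0 1) {x : Rn d} {q : ℝ}
    (hq : q ∈ lineSlice U j x) :
    sliceComp U j x q = Ioo (sliceInf U j q x) (sliceSup U j q x) := by
  have hb := bddBelow_sliceComp (j := j) hU1 x q
  have ha := bddAbove_sliceComp (j := j) hU1 x q
  have ho : IsOpen (sliceComp U j x q) := (isOpen_lineSlice hU j x).connectedComponentIn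
  refine Subset.antisymm ?_ (IsConnected.Ioo_csInf_csSup_subset
    ⟨⟨q, mem_connectedComponentIn hq⟩, isPreconnected_connectedComponentIn⟩ hb ha)
  intro t ht
  obtain ⟨ε, hε, h1⟩ := Metric.isOpen_iff.1 ho t ht
  rw [Real.ball_eq_Ioo] at h1
  have h2 : t - ε / 2 ∈ sliceComp U j x q := h1 ⟨by linarith, by linarith⟩
  have h3 : t + ε / 2 ∈ sliceComp U j x q := h1 ⟨by linarith, by linarith⟩
  exact ⟨(csInf_le hb h2).trans_lt (by linarith), lt_of_lt_of_le (by linarith) (le_csSup ha h3)⟩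

theorem sliceInf_lt_sliceSup (hU : IsOpen U) (hU1 : U ⊆ Icc 0 1) {x : Rn d} {q : ℝ}
    (hq : q ∈ lineSlice U j x) : sliceInf U j q x < sliceSup U j q x := by
  have h : q ∈ sliceComp U j x q := mem_connectedComponentIn hq
  rw [sliceComp_eq_Ioo hU hU1 hq] at h
  exact h.1.trans h.2

theorem measurable_sliceInf (hU : IsOpen U) (hU1 : U ⊆ Icc 0 1) (q : ℝ) :
    Measurable (sliceInf U j q) := by
  refine measurable_of_Iio fun c => ?_
  -- The second set accounts for lines where the component is empty: there `sInf ∅ = 0`.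
  have h1 : sliceInf U j q ⁻¹' Iio c = (⋃ r : ℚ, {x | (r : ℝ) < c ∧ (r : ℝ) ∈ sliceComp U j x q}) ∪
      ({x | q ∈ sliceComp U j x q}ᶜ ∩ {_x | 0 < c}) := by
    ext x
    by_cases hq : q ∈ lineSlice U j x
    · have hq' : q ∈ sliceComp U j x q := mem_connectedComponentIn hq
      simp only [mem_preimage, mem_Iio, mem_union, mem_iUnion, mem_ofPred_eq, mem_inter_iff,
        mem_compl_iff, hq', not_true, false_and, or_false]
      constructor
      · intro h
        rw [sliceComp_eq_Ioo hU hU1 hq] at hq' ⊢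
        obtain ⟨r, hr1, hr2⟩ := exists_rat_btwn (lt_min h (hq'.1.trans hq'.2))
        exact ⟨r, hr2.trans_le (min_le_left _ _), hr1, hr2.trans_le (min_le_right _ _)⟩
      · rintro ⟨r, hr, hr'⟩
        exact (csInf_le (bddBelow_sliceComp hU1 x q) hr').trans_lt hr
    · have h2 : sliceComp U j x q = ∅ := connectedComponentIn_eq_empty hq
      simp [sliceInf, h2]
  rw [h1]
  refine (MeasurableSet.iUnion fun r => ?_).union
    ((isOpen_setOf_mem_sliceComp hU q q).measurableSet.compl.inter (MeasurableSet.const _))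
  exact (MeasurableSet.const _).inter (isOpen_setOf_mem_sliceComp hU q r).measurableSet

theorem measurable_sliceSup (hU : IsOpen U) (hU1 : U ⊆ Icc 0 1) (q : ℝ) :
    Measurable (sliceSup U j q) := by
  refine measurable_of_Ioi fun c => ?_
  -- As for the infimum, the second set covers empty components, where `sSup ∅ = 0`.
  have h1 : sliceSup U j q ⁻¹' Ioi c = (⋃ r : ℚ, {x | c < (r : ℝ) ∧ (r : ℝ) ∈ sliceComp U j x q}) ∪
      ({x | q ∈ sliceComp U j x q}ᶜ ∩ {_x | c < 0}) := by
    ext x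
    by_cases hq : q ∈ lineSlice U j x
    · have hq' : q ∈ sliceComp U j x q := mem_connectedComponentIn hq
      simp only [mem_preimage, mem_Ioi, mem_union, mem_iUnion, mem_ofPred_eq, mem_inter_iff,
        mem_compl_iff, hq', not_true, false_and, or_false]
      constructor
      · intro h
        rw [sliceComp_eq_Ioo hU hU1 hq] at hq' ⊢
        obtain ⟨r, hr1, hr2⟩ := exists_rat_btwn (max_lt h (hq'.1.trans hq'.2))
        exact ⟨r, (le_max_left _ _).trans_lt hr1, (le_max_right _ _).trans_lt hr1, hr2⟩
      · rintro ⟨r, hr, hr'⟩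
        exact hr.trans_le (le_csSup (bddAbove_sliceComp hU1 x q) hr')
    · have h2 : sliceComp U j x q = ∅ := connectedComponentIn_eq_empty hq
      simp [sliceSup, h2]
  rw [h1]
  refine (MeasurableSet.iUnion fun r => ?_).union
    ((isOpen_setOf_mem_sliceComp hU q q).measurableSet.compl.inter (MeasurableSet.const _))
  exact (MeasurableSet.const _).inter (isOpen_setOf_mem_sliceComp hU q r).measurableSet

/-- A dense sequence of reals, used to enumerate the intervals of a slice. -/
noncomputable def slicePoint (n : ℕ) : ℝ := TopologicalSpace.denseSeq ℝ n

/-- The points on whose line the `n`-th interval of the slice exists: the `n`-th point is the first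
one in its interval. -/
def sliceIndex (U : Set (Rn d)) (j : Fin d) (n : ℕ) : Set (Rn d) :=
  {x | slicePoint n ∈ lineSlice U j x ∧ ∀ m < n, slicePoint m ∉ sliceComp U j x (slicePoint n)}

theorem update_mem_sliceIndex {n : ℕ} {x : Rn d} {t : ℝ} :
    Function.update x j t ∈ sliceIndex U j n ↔ x ∈ sliceIndex U j n := by
  simp only [sliceIndex, mem_ofPred_eq, lineSlice_update, sliceComp_update]

theorem measurableSet_sliceIndex (hU : IsOpen U) (n : ℕ) : MeasurableSet (sliceIndex U j n) := by
  have h1 : sliceIndex U j n = {x | slicePoint n ∈ sliceComp U j x (slicePoint n)} ∩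
      ⋂ m, ⋂ _ : m < n, {x | slicePoint m ∈ sliceComp U j x (slicePoint n)}ᶜ := by
    ext x
    simp [sliceIndex, mem_sliceComp]
  rw [h1]
  exact (isOpen_setOf_mem_sliceComp hU _ _).measurableSet.inter
    (MeasurableSet.iInter fun m => MeasurableSet.iInter fun _ =>
      (isOpen_setOf_mem_sliceComp hU _ _).measurableSet.compl)

theorem slicePoint_mem {n : ℕ} {x : Rn d} (hx : x ∈ sliceIndex U j n) :
    slicePoint n ∈ sliceComp U j x (slicePoint n) :=
  mem_connectedComponentIn hx.1

theorem eq_of_sliceComp_eq {n m : ℕ} {x : Rn d} (hn : x ∈ sliceIndex U j n)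
    (hm : x ∈ sliceIndex U j m)
    (h : sliceComp U j x (slicePoint n) = sliceComp U j x (slicePoint m)) : n = m := by
  rcases lt_trichotomy n m with h1 | h1 | h1
  · exact absurd (h ▸ slicePoint_mem hn) (hm.2 n h1)
  · exact h1
  · exact absurd (h ▸ slicePoint_mem hm) (hn.2 m h1)

theorem eq_of_mem_sliceComp {n m : ℕ} {x : Rn d} {t : ℝ} (hn : x ∈ sliceIndex U j n)
    (hm : x ∈ sliceIndex U j m) (htn : t ∈ sliceComp U j x (slicePoint n))
    (htm : t ∈ sliceComp U j x (slicePoint m)) : n = m :=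
  eq_of_sliceComp_eq hn hm ((connectedComponentIn_eq htn).trans (connectedComponentIn_eq htm).symm)

/-- The component of `t` is open and nonempty, so it meets the dense sequence; the least index that
lands in it is the one that names it. -/
theorem exists_sliceIndex (hU : IsOpen U) {x : Rn d} {t : ℝ} (ht : t ∈ lineSlice U j x) :
    ∃ n, x ∈ sliceIndex U j n ∧ t ∈ sliceComp U j x (slicePoint n) := by
  classical
  have h1 : ∃ n, slicePoint n ∈ sliceComp U j x t := by
    obtain ⟨_, hy, n, rfl⟩ := (TopologicalSpace.denseRange_denseSeq ℝ).inter_open_nonempty _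
      ((isOpen_lineSlice hU j x).connectedComponentIn (x := t)) ⟨t, mem_connectedComponentIn ht⟩
    exact ⟨n, hy⟩
  have h2 : sliceComp U j x t = sliceComp U j x (slicePoint (Nat.find h1)) :=
    connectedComponentIn_eq (Nat.find_spec h1)
  refine ⟨Nat.find h1, ⟨sliceComp_subset (Nat.find_spec h1), fun m hm => ?_⟩, ?_⟩
  · rw [← h2]
    exact Nat.find_min h1 hm
  · rw [← h2]
    exact mem_connectedComponentIn ht

end Slices

/-! ### Continuation along the slices of one piece. -/

section SliceExtension

variable {d : ℕ} {U : Set (Rn d)} {j : Fin d} {δ : ℝ} {n : ℕ} {G H : Rn d → ℝ}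
  {w : Rn d → ENNReal}

theorem measurable_update_self {c : Rn d → ℝ} (hc : Measurable c) (j : Fin d) :
    Measurable fun z : Rn d => Function.update z j (c z) := by
  refine measurable_pi_iff.2 fun i => ?_
  by_cases hi : i = j
  · subst hi
    simpa using hc
  · simpa [hi] using measurable_pi_apply i

theorem continuous_update_line (x : Rn d) (j : Fin d) : Continuous (Function.update x j) :=
  continuous_const.update j continuous_id

/-- The endpoints of the `n`-th interval, as functions of the line. -/
noncomputable abbrev sliceLeft (U : Set (Rn d)) (j : Fin d) (n : ℕ) (z : Rn d) : ℝ :=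
  sliceInf U j (slicePoint n) z

noncomputable abbrev sliceRight (U : Set (Rn d)) (j : Fin d) (n : ℕ) (z : Rn d) : ℝ :=
  sliceSup U j (slicePoint n) z

/-- `G` on the `n`-th interval of each slice, extended continuously beyond the interval with linear
decay to zero over the length `δ`. -/
noncomputable def sliceExt (U : Set (Rn d)) (j : Fin d) (δ : ℝ) (G : Rn d → ℝ) (n : ℕ) :
    Rn d → ℝ :=
  (sliceIndex U j n).indicator fun z =>
    G (Function.update z j (clamp (sliceLeft U j n z) (sliceRight U j n z) (z j))) *
      tent (sliceLeft U j n z) (sliceRight U j n z) δ (z j)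

/-- The slopes of `sliceExt` outside the interval. -/
noncomputable def sliceTail (U : Set (Rn d)) (j : Fin d) (δ : ℝ) (G : Rn d → ℝ) (n : ℕ) :
    Rn d → ℝ :=
  (sliceIndex U j n).indicator fun z =>
    tailSlope (sliceLeft U j n z) (sliceRight U j n z) δ (fun t => G (Function.update z j t)) (z j)

/-- The part of `U` that lies in the `n`-th interval of its slice. -/
def slicePart (U : Set (Rn d)) (j : Fin d) (n : ℕ) : Set (Rn d) :=
  {z | z ∈ sliceIndex U j n ∧ z j ∈ sliceComp U j z (slicePoint n)}

open Classical in
/-- The weight of the `n`-th interval of a slice in the complexity sum at `z`. -/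
noncomputable def sliceWeight (U : Set (Rn d)) (j : Fin d) (δ : ℝ) (w : Rn d → ENNReal) (n : ℕ)
    (z : Rn d) : ENNReal :=
  if z ∈ sliceIndex U j n ∧
      (Icc (z j - δ) (z j + δ) ∩ sliceComp U j z (slicePoint n)).Nonempty then
    ⨆ y ∈ sliceComp U j z (slicePoint n), w (Function.update z j y)
  else 0

theorem slicePart_eq (hU : IsOpen U) (hU1 : U ⊆ Icc 0 1) :
    slicePart U j n = sliceIndex U j n ∩ {z | sliceLeft U j n z < z j ∧
      z j < sliceRight U j n z} := by
  ext z
  refine and_congr_right fun hz => ?_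
  rw [sliceComp_eq_Ioo hU hU1 hz.1]
  rfl

theorem measurableSet_slicePart (hU : IsOpen U) (hU1 : U ⊆ Icc 0 1) :
    MeasurableSet (slicePart U j n) := by
  rw [slicePart_eq hU hU1]
  exact (measurableSet_sliceIndex hU n).inter
    ((measurableSet_lt (measurable_sliceInf hU hU1 _) (measurable_pi_apply j)).inter
      (measurableSet_lt (measurable_pi_apply j) (measurable_sliceSup hU hU1 _)))

theorem slicePart_subset : slicePart U j n ⊆ U := fun z hz => by
  have := sliceComp_subset hz.2
  simpa [lineSlice] using this

theorem measurable_sliceClamp (hU : IsOpen U) (hU1 : U ⊆ Icc 0 1) :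
    Measurable fun z : Rn d => clamp (sliceLeft U j n z) (sliceRight U j n z) (z j) :=
  (measurable_sliceInf hU hU1 _).max ((measurable_sliceSup hU hU1 _).min (measurable_pi_apply j))

theorem measurable_sliceExt (hU : IsOpen U) (hU1 : U ⊆ Icc 0 1) (hG : Measurable G) :
    Measurable (sliceExt U j δ G n) := by
  refine Measurable.indicator (Measurable.mul ?_ ?_) (measurableSet_sliceIndex hU n)
  · exact hG.comp (measurable_update_self (measurable_sliceClamp hU hU1) j)
  · have h1 := measurable_sliceClamp (j := j) (n := n) hU hU1
    have h2 := measurable_pi_apply (X := fun _ : Fin d => ℝ) j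
    exact measurable_const.max (measurable_const.sub (((h2.sub h1).abs).div_const δ))

theorem measurable_sliceTail (hU : IsOpen U) (hU1 : U ⊆ Icc 0 1) (hG : Measurable G) :
    Measurable (sliceTail U j δ G n) := by
  have hl := measurable_sliceInf (j := j) hU hU1 (slicePoint n)
  have hr := measurable_sliceSup (j := j) hU hU1 (slicePoint n)
  have hj := measurable_pi_apply (X := fun _ : Fin d => ℝ) j
  have hg : Measurable fun z => G (Function.update z j
      (clamp (sliceLeft U j n z) (sliceRight U j n z) (z j))) / δ :=
    (hG.comp (measurable_update_self (measurable_sliceClamp hU hU1) j)).div_const δ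
  refine Measurable.indicator (Measurable.sub ?_ ?_) (measurableSet_sliceIndex hU n)
  · exact hg.indicator ((measurableSet_lt (hl.sub_const δ) hj).inter (measurableSet_lt hj hl))
  · exact hg.indicator ((measurableSet_lt hr hj).inter (measurableSet_lt hj (hr.add_const δ)))

theorem update_mem_closure (hU : IsOpen U) (hU1 : U ⊆ Icc 0 1) {x : Rn d}
    (hx : x ∈ sliceIndex U j n) {t : ℝ} (ht : t ∈ Icc (sliceLeft U j n x) (sliceRight U j n x)) :
    Function.update x j t ∈ closure U := by
  rw [← closure_Ioo (sliceInf_lt_sliceSup hU hU1 hx.1).ne, ← sliceComp_eq_Ioo hU hU1 hx.1] at ht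
  exact map_mem_closure (continuous_const.update j continuous_id) ht
    fun s hs => sliceComp_subset hs

/-- A bound on the open interval persists at its endpoints by continuity. This is where the
continuous extension to the closure of the piece is needed. -/
theorem enorm_update_le (hU : IsOpen U) (hU1 : U ⊆ Icc 0 1) (hGc : ContinuousOn G (closure U))
    (hGw : ∀ z ∈ U, ‖G z‖ₑ ≤ w z) {x : Rn d} (hx : x ∈ sliceIndex U j n) {t : ℝ}
    (ht : t ∈ Icc (sliceLeft U j n x) (sliceRight U j n x)) :
    ‖G (Function.update x j t)‖ₑ ≤
      ⨆ y ∈ sliceComp U j x (slicePoint n), w (Function.update x j y) := by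
  set M := ⨆ y ∈ sliceComp U j x (slicePoint n), w (Function.update x j y)
  have h1 : ContinuousOn (fun t => ‖G (Function.update x j t)‖ₑ)
      (Icc (sliceLeft U j n x) (sliceRight U j n x)) :=
    continuous_enorm.comp_continuousOn (hGc.comp
      (continuous_update_line x j).continuousOn
      fun t ht => update_mem_closure hU hU1 hx ht)
  have h2 : closure (sliceComp U j x (slicePoint n)) =
      Icc (sliceLeft U j n x) (sliceRight U j n x) := by
    rw [sliceComp_eq_Ioo hU hU1 hx.1, closure_Ioo (sliceInf_lt_sliceSup hU hU1 hx.1).ne]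
  rw [← h2] at h1 ht
  refine (isClosed_Iic (a := M)).closure_subset_iff.2 ?_ (h1.image_closure ⟨t, ht, rfl⟩)
  rintro _ ⟨s, hs, rfl⟩
  exact (hGw _ (sliceComp_subset hs)).trans (le_iSup₂ (f := fun y _ => w (Function.update x j y)) s hs)

/-- The clamped point may be an endpoint, which is not in the interval. Because its distance to `z
j` is strictly below `δ`, nearby interior points still lie in the window, so the interval is counted
in the complexity sum. -/
theorem enorm_sliceClamp_le (hU : IsOpen U) (hU1 : U ⊆ Icc 0 1) (hGc : ContinuousOn G (closure U))
    (hGw : ∀ z ∈ U, ‖G z‖ₑ ≤ w z) {z : Rn d} (hz : z ∈ sliceIndex U j n)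
    (h : |z j - clamp (sliceLeft U j n z) (sliceRight U j n z) (z j)| < δ) :
    ‖G (Function.update z j (clamp (sliceLeft U j n z) (sliceRight U j n z) (z j)))‖ₑ ≤
      sliceWeight U j δ w n z := by
  have hlt := sliceInf_lt_sliceSup hU hU1 hz.1
  have hc := clamp_mem hlt.le (z j)
  have h2 : (Icc (z j - δ) (z j + δ) ∩ sliceComp U j z (slicePoint n)).Nonempty := by
    rw [sliceComp_eq_Ioo hU hU1 hz.1]
    rw [← closure_Ioo hlt.ne] at hc
    have h3 : clamp (sliceLeft U j n z) (sliceRight U j n z) (z j) ∈ Ioo (z j - δ) (z j + δ) := by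
      rw [abs_sub_lt_iff] at h
      exact ⟨by linarith, by linarith⟩
    obtain ⟨y, hy1, hy2⟩ := mem_closure_iff.1 hc _ isOpen_Ioo h3
    exact ⟨y, Ioo_subset_Icc_self hy1, hy2⟩
  rw [sliceWeight, if_pos ⟨hz, h2⟩]
  exact enorm_update_le hU hU1 hGc hGw hz (clamp_mem hlt.le (z j))

theorem enorm_sliceExt_le (hU : IsOpen U) (hU1 : U ⊆ Icc 0 1) (hδ : 0 < δ)
    (hGc : ContinuousOn G (closure U)) (hGw : ∀ z ∈ U, ‖G z‖ₑ ≤ w z) (z : Rn d) :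
    ‖sliceExt U j δ G n z‖ₑ ≤ sliceWeight U j δ w n z := by
  by_cases hz : z ∈ sliceIndex U j n
  · rw [sliceExt, indicator_of_mem hz, enorm_mul]
    by_cases ht : tent (sliceLeft U j n z) (sliceRight U j n z) δ (z j) = 0
    · simp [ht]
    · refine (mul_le_of_le_one_right' ?_).trans
        (enorm_sliceClamp_le hU hU1 hGc hGw hz (abs_sub_clamp_lt_of_tent_ne_zero hδ ht))
      rw [← ofReal_norm, Real.norm_of_nonneg (tent_nonneg _ _ _ _), ENNReal.ofReal_le_one]
      exact tent_le_one hδ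
  · simp [sliceExt, hz]

/-- The slope is the boundary value divided by `δ`. The box records that the tails stay within `δ`
of the cube, which later makes their sum integrable. -/
theorem enorm_sliceTail_le (hU : IsOpen U) (hU1 : U ⊆ Icc 0 1) (hδ : 0 < δ)
    (hGc : ContinuousOn G (closure U)) (hGw : ∀ z ∈ U, ‖G z‖ₑ ≤ w z) (z : Rn d) :
    ‖sliceTail U j δ G n z‖ₑ ≤ (Icc (fun _ => -δ) (fun _ => 1 + δ) : Set (Rn d)).indicator
      (fun z => sliceWeight U j δ w n z * ENNReal.ofReal δ⁻¹) z := by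
  by_cases hz : z ∈ sliceIndex U j n
  swap
  · simp [sliceTail, hz]
  have hlt := sliceInf_lt_sliceSup hU hU1 hz.1
  set a := sliceLeft U j n z with ha
  set b := sliceRight U j n z with hb
  rw [sliceTail, indicator_of_mem hz, ← ha, ← hb, tailSlope]
  by_cases hmem : z j ∈ Ioo (a - δ) a ∪ Ioo b (b + δ)
  swap
  · rw [mem_union, not_or] at hmem
    rw [indicator_of_notMem hmem.1, indicator_of_notMem hmem.2]
    simp
  have hcl : |z j - clamp a b (z j)| < δ := by
    rcases hmem with h | h
    · rw [clamp_of_le h.2.le, abs_sub_comm, abs_of_pos (sub_pos.2 h.2)]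
      linarith [h.1]
    · rw [clamp_of_ge hlt.le h.1.le, abs_of_pos (sub_pos.2 h.1)]
      linarith [h.2]
  have hbox : z ∈ (Icc (fun _ => -δ) (fun _ => 1 + δ) : Set (Rn d)) := by
    have h1 := hU1 hz.1
    have h2 := closure_minimal hU1 isClosed_Icc
      (update_mem_closure hU hU1 hz (clamp_mem hlt.le (z j)))
    have h3 := h2.1 j
    have h4 := h2.2 j
    simp only [Function.update_self, Pi.zero_apply, Pi.one_apply] at h3 h4
    rw [abs_sub_lt_iff] at hcl
    have h5 : ∀ i, -δ ≤ z i ∧ z i ≤ 1 + δ := fun i => by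
      by_cases hi : i = j
      · subst hi
        constructor <;> linarith
      · have h5 := h1.1 i
        have h6 := h1.2 i
        simp only [Function.update_of_ne hi, Pi.zero_apply, Pi.one_apply] at h5 h6
        constructor <;> linarith
    exact ⟨fun i => (h5 i).1, fun i => (h5 i).2⟩
  rw [indicator_of_mem hbox]
  have h6 : ‖(Ioo (a - δ) a).indicator (fun t => G (Function.update z j (clamp a b t)) / δ) (z j) -
      (Ioo b (b + δ)).indicator (fun t => G (Function.update z j (clamp a b t)) / δ) (z j)‖ₑ =
      ‖G (Function.update z j (clamp a b (z j)))‖ₑ * ENNReal.ofReal δ⁻¹ := by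
    rw [← Real.enorm_of_nonneg (inv_nonneg.2 hδ.le), ← enorm_mul, ← div_eq_mul_inv]
    rcases hmem with h | h
    · rw [indicator_of_mem h, indicator_of_notMem, sub_zero]
      exact fun h' => (h.2.trans (hlt.trans h'.1)).false
    · rw [indicator_of_mem h, indicator_of_notMem, zero_sub, enorm_neg]
      exact fun h' => (h'.2.trans (hlt.trans h.1)).false
  rw [h6]
  gcongr
  exact enorm_sliceClamp_le hU hU1 hGc hGw hz hcl

theorem hasWeakPartial_sliceExt (hU : IsOpen U) (hU1 : U ⊆ Icc 0 1) (hδ : 0 < δ)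
    (hGm : Measurable G) (hGc : ContinuousOn G (closure U))
    (hGH : ∀ z ∈ U, HasDerivAt (fun t => G (Function.update z j t)) (H z) (z j)) {C : ℝ}
    (hC : ∀ z, |sliceExt U j δ G n z| ≤ C)
    (hi : Integrable fun z => (slicePart U j n).indicator H z + sliceTail U j δ G n z) :
    HasWeakPartial j (sliceExt U j δ G n)
      fun z => (slicePart U j n).indicator H z + sliceTail U j δ G n z := by
  refine HasWeakPartial.of_lines (measurable_sliceExt hU hU1 hGm) hC hi fun x hx => ?_
  by_cases hxn : x ∈ sliceIndex U j n
  · have hlt := sliceInf_lt_sliceSup hU hU1 hxn.1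
    have h1 : (fun t => (slicePart U j n).indicator H (Function.update x j t) +
        sliceTail U j δ G n (Function.update x j t)) = fun t =>
        (Ioo (sliceLeft U j n x) (sliceRight U j n x)).indicator
          (fun t => H (Function.update x j t)) t +
        tailSlope (sliceLeft U j n x) (sliceRight U j n x) δ
          (fun t => G (Function.update x j t)) t := by
      funext t
      congr 1
      · by_cases ht : t ∈ Ioo (sliceLeft U j n x) (sliceRight U j n x)
        · rw [indicator_of_mem ht, indicator_of_mem]
          refine ⟨update_mem_sliceIndex.2 hxn, ?_⟩
          rw [sliceComp_update, Function.update_self, sliceComp_eq_Ioo hU hU1 hxn.1]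
          exact ht
        · rw [indicator_of_notMem ht, indicator_of_notMem]
          intro h
          refine ht ?_
          rw [← sliceComp_eq_Ioo hU hU1 hxn.1]
          have := h.2
          rwa [sliceComp_update, Function.update_self] at this
      · rw [sliceTail, indicator_of_mem (update_mem_sliceIndex.2 hxn)]
        simp only [sliceLeft, sliceRight, sliceInf, sliceSup, sliceComp_update,
          Function.update_idem, Function.update_self]
    have h2 : (fun t => sliceExt U j δ G n (Function.update x j t)) = fun t =>
        (fun t => G (Function.update x j t)) (clamp (sliceLeft U j n x) (sliceRight U j n x) t) *
          tent (sliceLeft U j n x) (sliceRight U j n x) δ t := by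
      funext t
      rw [sliceExt, indicator_of_mem (update_mem_sliceIndex.2 hxn)]
      simp only [sliceLeft, sliceRight, sliceInf, sliceSup, sliceComp_update,
        Function.update_idem, Function.update_self]
    rw [h1] at hx ⊢
    rw [h2]
    refine hasWeakDeriv_mul_tent hlt hδ ?_ (fun t ht => ?_) hx
    · exact hGc.comp (continuous_update_line x j).continuousOn
        fun t ht => update_mem_closure hU hU1 hxn ht
    · rw [← sliceComp_eq_Ioo hU hU1 hxn.1] at ht
      have := hGH _ (sliceComp_subset ht)
      simpa only [Function.update_idem, Function.update_self] using this
  · have h1 : ∀ t, Function.update x j t ∉ sliceIndex U j n := fun t h =>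
      hxn (update_mem_sliceIndex.1 h)
    have h2 : ∀ t, Function.update x j t ∉ slicePart U j n := fun t h => h1 t h.1
    intro η _ _
    simp [sliceExt, sliceTail, h1, h2]

/-- Distinct indices name distinct intervals, so no term of the complexity sum is used twice. -/
theorem tsum_sliceWeight_le (T : Rn d → Rn d) (z : Rn d) :
    ∑' n, sliceWeight U j δ (fun z => rowSumNorm (jacInv T z)) n z ≤
      ∑' I : {I : Set ℝ // I ∈ sliceIntervals U j z ∧ (Icc (z j - δ) (z j + δ) ∩ I).Nonempty},
        ⨆ y ∈ I.1, rowSumNorm (jacInv T (Function.update z j y)) := by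
  set S : Set ℕ := {n | z ∈ sliceIndex U j n ∧
    (Icc (z j - δ) (z j + δ) ∩ sliceComp U j z (slicePoint n)).Nonempty} with hS
  have h1 : Function.support (fun n => sliceWeight U j δ (fun z => rowSumNorm (jacInv T z)) n z) ⊆
      S := fun n hn => by
    by_contra h
    exact hn (if_neg h)
  let e : S → {I : Set ℝ // I ∈ sliceIntervals U j z ∧
      (Icc (z j - δ) (z j + δ) ∩ I).Nonempty} := fun n =>
    ⟨sliceComp U j z (slicePoint n.1), ⟨_, n.2.1.1, rfl⟩, n.2.2⟩
  have he : Function.Injective e := fun n m h =>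
    Subtype.ext (eq_of_sliceComp_eq n.2.1 m.2.1 (congrArg Subtype.val h))
  rw [← tsum_subtype_eq_of_support_subset h1]
  refine le_trans (le_of_eq (tsum_congr fun n => ?_)) (ENNReal.tsum_comp_le_tsum_of_injective he _)
  exact if_pos n.2

/-- The contraction hypothesis is available only inside the cube, whereas continuations reach
outside it. Intervals lie in `[0, 1]`, and projecting `z j` to `[0, 1]` brings it no farther from
any of their points, so no interval is lost. -/
theorem sliceWeight_le_clamp (hU1 : U ⊆ Icc 0 1) (z : Rn d) :
    sliceWeight U j δ w n z ≤ sliceWeight U j δ w n (Function.update z j (clamp 0 1 (z j))) := by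
  rw [sliceWeight]
  split_ifs with h
  · obtain ⟨hz, y, ⟨hy1, hy2⟩, hy⟩ := h
    have hy01 := lineSlice_subset hU1 j z (sliceComp_subset hy)
    have h3 : y ∈ Icc (clamp 0 1 (z j) - δ) (clamp 0 1 (z j) + δ) := by
      have hδ : 0 ≤ δ := by linarith
      simp only [clamp]
      constructor
      · rw [sub_le_iff_le_add, max_le_iff]
        exact ⟨by linarith [hy01.1], (min_le_right _ _).trans (by linarith)⟩
      · rw [← sub_le_iff_le_add, le_max_iff, le_min_iff]
        exact Or.inr ⟨by linarith [hy01.2], by linarith⟩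
    rw [sliceWeight, if_pos]
    · simp only [sliceComp_update, Function.update_idem, le_refl]
    · refine ⟨update_mem_sliceIndex.2 hz, y, ?_, ?_⟩
      · rwa [Function.update_self]
      · rwa [sliceComp_update]
  · exact zero_le

end SliceExtension

/-! ### Gluing the continuations of all pieces; primitives along lines. -/

section GluedExtension

variable {d : ℕ} {ι : Type*} {Ω : Set (Rn d)} {P : ι → Set (Rn d)} {T : Rn d → Rn d} {δ lam : ℝ}

theorem IsPiecewiseExpanding.piece_subset_cube (hT : IsPiecewiseExpanding Ω P T δ lam) (k : ι) :
    P k ⊆ Icc 0 1 :=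
  (hT.piece_subset k).trans hT.subset_cube

theorem IsPiecewiseExpanding.tsum_sliceWeight_le (hT : IsPiecewiseExpanding Ω P T δ lam)
    (j : Fin d) (z : Rn d) :
    ∑' p : ι × ℕ, sliceWeight (P p.1) j δ (fun z => rowSumNorm (jacInv T z)) p.2 z ≤
      ENNReal.ofReal lam⁻¹ := by
  set z' := Function.update z j (clamp 0 1 (z j))
  refine (ENNReal.tsum_le_tsum fun p : ι × ℕ =>
    sliceWeight_le_clamp (hT.piece_subset_cube p.1) z).trans ?_
  by_cases hz : z' ∈ Icc (0 : Rn d) 1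
  · refine le_trans ?_ (hT.contraction z' hz j)
    rw [ENNReal.tsum_prod', contractionSum]
    exact ENNReal.tsum_le_tsum fun k => _root_.tsum_sliceWeight_le T z'
  -- If the projected point is still outside the cube, then another coordinate leaves `[0, 1]`; the
  -- whole line misses the pieces and every weight vanishes.
  · refine le_of_eq_of_le (ENNReal.tsum_eq_zero.2 fun p => if_neg ?_) (zero_le)
    rintro ⟨h1, -⟩
    have h2 := hT.piece_subset_cube p.1 h1.1
    have h3 := clamp_mem zero_le_one (z j)
    refine hz ⟨fun i => ?_, fun i => ?_⟩
    · by_cases hi : i = j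
      · subst hi
        simpa [z'] using h3.1
      · simpa [z', hi] using h2.1 i
    · by_cases hi : i = j
      · subst hi
        simpa [z'] using h3.2
      · simpa [z', hi] using h2.2 i

theorem IsPiecewiseExpanding.existsUnique_slicePart (hT : IsPiecewiseExpanding Ω P T δ lam)
    (j : Fin d) {z : Rn d} (hz : z ∈ Ω) : ∃! p : ι × ℕ, z ∈ slicePart (P p.1) j p.2 := by
  rw [← hT.iUnion_piece, mem_iUnion] at hz
  obtain ⟨k, hk⟩ := hz
  obtain ⟨n, hn, hn'⟩ := exists_sliceIndex (hT.piece_isOpen k) (x := z) (j := j) (t := z j)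
    (by simpa [lineSlice] using hk)
  refine ⟨(k, n), ⟨hn, hn'⟩, ?_⟩
  rintro ⟨l, m⟩ hp
  obtain rfl : l = k := by
    by_contra hne
    exact (hT.piece_disjoint hne).le_bot ⟨slicePart_subset hp, hk⟩
  exact Prod.ext rfl (eq_of_mem_sliceComp hp.1 hn hp.2 hn')

/-- The slice parts of all pieces partition `Ω`, so at most one term is nonzero. -/
theorem IsPiecewiseExpanding.slicePart_indicator (hT : IsPiecewiseExpanding Ω P T δ lam)
    (j : Fin d) {H : Rn d → ℝ} (hH : ∀ z ∉ Ω, H z = 0) (z : Rn d) :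
    HasSum (fun p : ι × ℕ => (slicePart (P p.1) j p.2).indicator H z) (H z) ∧
      ∑' p : ι × ℕ, ‖(slicePart (P p.1) j p.2).indicator H z‖ₑ = ‖H z‖ₑ := by
  by_cases hz : z ∈ Ω
  · obtain ⟨p, hp, huniq⟩ := hT.existsUnique_slicePart j hz
    have h0 : ∀ q, q ≠ p → (slicePart (P q.1) j q.2).indicator H z = 0 := fun q hq =>
      indicator_of_notMem (fun h => hq (huniq q h)) H
    have h1 : (slicePart (P p.1) j p.2).indicator H z = H z := indicator_of_mem hp H
    refine ⟨?_, ?_⟩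
    · rw [← h1]
      exact hasSum_single p h0
    · rw [← h1]
      exact tsum_eq_single p fun q hq => by rw [h0 q hq, enorm_zero]
  · have h0 : ∀ q : ι × ℕ, (slicePart (P q.1) j q.2).indicator H z = 0 := fun q =>
      indicator_of_notMem (fun h => hz (hT.piece_subset _ (slicePart_subset h))) H
    simp [h0, hH z hz, hasSum_zero]

variable [Countable ι]

/-- A function that is continuous on the closures of the pieces differs from a function that is
continuous along the lines in the `j`-th direction by a function of bounded slope. -/
theorem IsPiecewiseExpanding.exists_glued_extension (hT : IsPiecewiseExpanding Ω P T δ lam)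
    (j : Fin d) {G : ι → Rn d → ℝ} {H : Rn d → ℝ} (hGm : ∀ k, Measurable (G k))
    (hGc : ∀ k, ContinuousOn (G k) (closure (P k)))
    (hGw : ∀ k, ∀ z ∈ P k, ‖G k z‖ₑ ≤ rowSumNorm (jacInv T z))
    (hGH : ∀ k, ∀ z ∈ P k, HasDerivAt (fun t => G k (Function.update z j t)) (H z) (z j))
    (hHm : Measurable H) (hHi : Integrable H) (hH0 : ∀ z ∉ Ω, H z = 0) :
    ∃ θ S : Rn d → ℝ, Measurable θ ∧ Measurable S ∧ (∀ z, |θ z| ≤ lam⁻¹) ∧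
      (∀ z, |S z| ≤ lam⁻¹ * δ⁻¹) ∧ HasWeakPartial j θ fun z => H z + S z := by
  have hlam : 0 ≤ lam⁻¹ := inv_nonneg.2 (zero_le_one.trans hT.one_lt_lam.le)
  have hδ' : 0 ≤ δ⁻¹ := inv_nonneg.2 hT.δ_pos.le
  set E : ι × ℕ → Rn d → ℝ := fun p => sliceExt (P p.1) j δ (G p.1) p.2
  set A : ι × ℕ → Rn d → ℝ := fun p => (slicePart (P p.1) j p.2).indicator H
  set S : ι × ℕ → Rn d → ℝ := fun p => sliceTail (P p.1) j δ (G p.1) p.2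
  set W : ι × ℕ → Rn d → ENNReal := fun p =>
    sliceWeight (P p.1) j δ (fun z => rowSumNorm (jacInv T z)) p.2
  obtain ⟨box, hbox⟩ : ∃ box : Set (Rn d), box = Icc (fun _ => -δ) (fun _ => 1 + δ) := ⟨_, rfl⟩
  have hEm : ∀ p, Measurable (E p) := fun p =>
    measurable_sliceExt (hT.piece_isOpen _) (hT.piece_subset_cube _) (hGm _)
  have hSm : ∀ p, Measurable (S p) := fun p =>
    measurable_sliceTail (hT.piece_isOpen _) (hT.piece_subset_cube _) (hGm _)
  have hAm : ∀ p, Measurable (A p) := fun p =>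
    hHm.indicator (measurableSet_slicePart (hT.piece_isOpen _) (hT.piece_subset_cube _))
  have hW : ∀ z, ∑' p, W p z ≤ ENNReal.ofReal lam⁻¹ := hT.tsum_sliceWeight_le j
  have hE1 : ∀ z, ∑' p, ‖E p z‖ₑ ≤ ENNReal.ofReal lam⁻¹ := fun z =>
    (ENNReal.tsum_le_tsum fun p => enorm_sliceExt_le (hT.piece_isOpen _)
      (hT.piece_subset_cube _) hT.δ_pos (hGc _) (hGw _) z).trans (hW z)
  have hS1 : ∀ z, ∑' p, ‖S p z‖ₑ ≤
      box.indicator (fun _ => ENNReal.ofReal (lam⁻¹ * δ⁻¹)) z := fun z => by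
    refine (ENNReal.tsum_le_tsum fun p => enorm_sliceTail_le (hT.piece_isOpen _)
      (hT.piece_subset_cube _) hT.δ_pos (hGc _) (hGw _) z).trans ?_
    rw [← hbox]
    by_cases hz : z ∈ box
    · simp only [indicator_of_mem hz]
      rw [ENNReal.tsum_mul_right, ENNReal.ofReal_mul hlam]
      gcongr
      exact hW z
    · simp [indicator_of_notMem hz]
  have hS2 : ∀ z, ∑' p, ‖S p z‖ₑ ≤ ENNReal.ofReal (lam⁻¹ * δ⁻¹) := fun z =>
    (hS1 z).trans (indicator_le_self' (fun _ _ => zero_le) z)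
  have hSs : ∀ z, Summable fun p => S p z := fun z =>
    (ENNReal.tsum_coe_ne_top_iff_summable_coe.1
      ((hS2 z).trans_lt ENNReal.ofReal_lt_top).ne).of_norm
  have habs : ∀ {r C : ℝ}, 0 ≤ C → ‖r‖ₑ ≤ ENNReal.ofReal C → |r| ≤ C := fun hC h => by
    rw [← ofReal_norm, ENNReal.ofReal_le_ofReal_iff hC] at h
    exact h
  -- The interior derivatives live on disjoint sets and add up to `‖H‖`; the slopes add up to a
  -- bounded function on a box of finite volume.
  have hI : ∫⁻ z, ∑' p, ‖A p z + S p z‖ₑ ≠ ⊤ := by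
    have h1 : ∀ z, ∑' p, ‖A p z + S p z‖ₑ ≤
        ‖H z‖ₑ + box.indicator (fun _ => ENNReal.ofReal (lam⁻¹ * δ⁻¹)) z := fun z =>
      calc _ ≤ ∑' p, (‖A p z‖ₑ + ‖S p z‖ₑ) := ENNReal.tsum_le_tsum fun p => enorm_add_le _ _
        _ ≤ _ := by
          rw [ENNReal.tsum_add, (hT.slicePart_indicator j hH0 z).2]
          gcongr
          exact hS1 z
    refine ((lintegral_mono h1).trans_lt ?_).ne
    rw [lintegral_add_left hHm.enorm, hbox, lintegral_indicator measurableSet_Icc, setLIntegral_const]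
    exact ENNReal.add_lt_top.2 ⟨hHi.2,
      ENNReal.mul_lt_top ENNReal.ofReal_lt_top isCompact_Icc.measure_lt_top⟩
  refine ⟨fun z => ∑' p, E p z, fun z => ∑' p, S p z, Measurable.tsum hEm, Measurable.tsum hSm,
    fun z => habs hlam (enorm_tsum_le_tsum_enorm.trans (hE1 z)),
    fun z => habs (mul_nonneg hlam hδ') (enorm_tsum_le_tsum_enorm.trans (hS2 z)), ?_⟩
  have h2 : (fun z => H z + ∑' p, S p z) = fun z => ∑' p, (A p z + S p z) := by
    funext z
    have := (hT.slicePart_indicator j hH0 z).1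
    rw [Summable.tsum_add this.summable (hSs z), this.tsum_eq]
  rw [h2]
  refine HasWeakPartial.tsum (F := E) (F' := fun p z => A p z + S p z) (fun p => ?_) hEm
    (fun p => (hAm p).add (hSm p)) ENNReal.ofReal_ne_top hE1 hI
  refine hasWeakPartial_sliceExt (hT.piece_isOpen _) (hT.piece_subset_cube _) hT.δ_pos (hGm _)
    (hGc _) (hGH _) (C := lam⁻¹) (fun z => habs hlam ((ENNReal.le_tsum p).trans (hE1 z))) ?_
  refine ⟨((hAm p).add (hSm p)).aestronglyMeasurable, lt_of_le_of_lt ?_ hI.lt_top⟩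
  exact lintegral_mono fun z => ENNReal.le_tsum (f := fun p => ‖A p z + S p z‖ₑ) p

/-- The primitive along the `j`-th axis. -/
theorem exists_line_primitive (j : Fin d) {G : Rn d → ℝ} (hGm : Measurable G)
    (hG0 : ∀ z ∉ Icc (0 : Rn d) 1, G z = 0) {η : ℝ} (hη : 0 ≤ η)
    (hG : ∀ x, ∫⁻ t, ‖G (Function.update x j t)‖ₑ ≤ ENNReal.ofReal η) :
    Integrable G ∧ ∃ g : Rn d → ℝ, Measurable g ∧ (∀ z, |g z| ≤ η) ∧ HasWeakPartial j g G := by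
  have hi : Integrable G := ⟨hGm.aestronglyMeasurable, (lintegral_le_of_lines j hGm.enorm
    (fun z hz => by rw [hG0 z hz, enorm_zero]) hG).trans_lt ENNReal.ofReal_lt_top⟩
  set g : Rn d → ℝ := fun z => ∫ t, (Iio (z j)).indicator (fun t => G (Function.update z j t)) t
    with hg
  have hgm : Measurable g := by
    have h1 : Measurable fun p : Rn d × ℝ => Function.update p.1 j p.2 :=
      (continuous_fst.update j continuous_snd).measurable
    have h2 : MeasurableSet {p : Rn d × ℝ | p.2 < p.1 j} :=
      measurableSet_lt measurable_snd ((measurable_pi_apply j).comp measurable_fst)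
    have h3 := ((hGm.comp h1).indicator h2).stronglyMeasurable.integral_prod_right' (ν := volume)
    exact h3.measurable
  have hgb : ∀ z, |g z| ≤ η := fun z => by
    have h1 : ‖g z‖ₑ ≤ ENNReal.ofReal η := by
      refine (enorm_integral_le_lintegral_enorm _).trans (le_trans (lintegral_mono fun t => ?_)
        (hG z))
      simp only [enorm_indicator_eq_indicator_enorm]
      exact indicator_le_self' (fun _ _ => zero_le) t
    rw [← ofReal_norm, ENNReal.ofReal_le_ofReal_iff hη] at h1
    exact h1
  refine ⟨hi, g, hgm, hgb, HasWeakPartial.of_lines hgm hgb hi fun x hx => ?_⟩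
  have := hasWeakDeriv_primitive hx
  simpa only [hg, Function.update_idem, Function.update_self] using this

end GluedExtension

/-! ### Regularity of the inverse Jacobian. -/

section Regularity

variable {d : ℕ} {ι : Type*} {Ω : Set (Rn d)} {P : ι → Set (Rn d)} {T : Rn d → Rn d} {δ lam : ℝ}

theorem contDiffAt_det {M : Rn d → Matrix (Fin d) (Fin d) ℝ} {x : Rn d}
    (h : ∀ a b, ContDiffAt ℝ 1 (fun y => M y a b) x) : ContDiffAt ℝ 1 (fun y => (M y).det) x := by
  simp only [Matrix.det_apply]
  exact ContDiffAt.sum fun σ _ => (contDiffAt_prod fun i _ => h _ _).const_smul _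

/-- Cramer's rule writes the entries as quotients of determinants. -/
theorem contDiffAt_inv_apply {M : Rn d → Matrix (Fin d) (Fin d) ℝ} {x : Rn d}
    (h : ∀ a b, ContDiffAt ℝ 1 (fun y => M y a b) x) (h0 : (M x).det ≠ 0) (a b : Fin d) :
    ContDiffAt ℝ 1 (fun y => (M y)⁻¹ a b) x := by
  simp only [Matrix.inv_def, Ring.inverse_eq_inv', Matrix.smul_apply, Matrix.adjugate_apply,
    smul_eq_mul]
  refine ((contDiffAt_det h).inv h0).mul (contDiffAt_det fun c e => ?_)
  by_cases hc : c = b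
  · subst hc
    simpa using contDiffAt_const
  · simpa [Matrix.updateRow_ne hc] using h c e

theorem jac_apply (T : Rn d → Rn d) (x : Rn d) (a b : Fin d) :
    jac T x a b = fderiv ℝ T x (Pi.single b 1) a := by
  rw [jac, LinearMap.toMatrix'_apply]
  rfl

theorem IsPiecewiseExpanding.contDiffAt_jac (hT : IsPiecewiseExpanding Ω P T δ lam) {x : Rn d}
    (hx : x ∈ Ω) (a b : Fin d) : ContDiffAt ℝ 1 (fun y => jac T y a b) x := by
  rw [← hT.iUnion_piece, mem_iUnion] at hx
  obtain ⟨k, hk⟩ := hx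
  simp only [jac_apply]
  have h1 : ContDiffAt ℝ 1 (fderiv ℝ T) x :=
    (hT.contDiffAt hk).fderiv_right (m := 1) (by norm_num)
  exact contDiffAt_pi.1 (h1.clm_apply contDiffAt_const) a

theorem IsPiecewiseExpanding.det_jac_ne_zero (hT : IsPiecewiseExpanding Ω P T δ lam) {x : Rn d}
    (hx : x ∈ Ω) : (jac T x).det ≠ 0 := by
  rw [← hT.iUnion_piece, mem_iUnion] at hx
  obtain ⟨k, hk⟩ := hx
  rw [det_jac]
  exact hT.det_fderiv_ne_zero hk

theorem IsPiecewiseExpanding.contDiffAt_jacInv (hT : IsPiecewiseExpanding Ω P T δ lam) {x : Rn d}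
    (hx : x ∈ Ω) (a b : Fin d) : ContDiffAt ℝ 1 (fun y => jacInv T y a b) x :=
  contDiffAt_inv_apply (hT.contDiffAt_jac hx) (hT.det_jac_ne_zero hx) a b

theorem IsPiecewiseExpanding.hasDerivAt_jacInv (hT : IsPiecewiseExpanding Ω P T δ lam) {x : Rn d}
    (hx : x ∈ Ω) (j a b : Fin d) :
    HasDerivAt (fun t => jacInv T (Function.update x j t) a b) (partialJacInv T j x a b) (x j) ∧
      partialJacInv T j x a b = fderiv ℝ (fun y => jacInv T y a b) x (Pi.single j 1) := by
  have h1 : HasDerivAt (fun t => jacInv T (Function.update x j t) a b)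
      (fderiv ℝ (fun y => jacInv T y a b) x (Pi.single j 1)) (x j) := by
    have h2 := ((hT.contDiffAt_jacInv hx a b).differentiableAt one_ne_zero).hasFDerivAt
    rw [← Function.update_eq_self j x] at h2
    have h3 := h2.comp_hasDerivAt (x j) (hasDerivAt_update x j (x j))
    rwa [Function.update_eq_self] at h3
  have h4 : partialJacInv T j x a b = fderiv ℝ (fun y => jacInv T y a b) x (Pi.single j 1) :=
    h1.deriv
  exact ⟨h4 ▸ h1, h4⟩

theorem IsPiecewiseExpanding.continuousOn_partialJacInv (hT : IsPiecewiseExpanding Ω P T δ lam)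
    (j a b : Fin d) : ContinuousOn (fun x => partialJacInv T j x a b) Ω := by
  have h1 : ContinuousOn (fun x => fderiv ℝ (fun y => jacInv T y a b) x (Pi.single j 1)) Ω :=
    fun x hx => (((hT.contDiffAt_jacInv hx a b).fderiv_right (m := 0)
      (by norm_num)).continuousAt.clm_apply continuousAt_const).continuousWithinAt
  exact h1.congr fun x hx => (hT.hasDerivAt_jacInv hx j a b).2

theorem measurable_indicator_of_continuousOn {f : Rn d → ℝ} {s : Set (Rn d)} (hs : IsOpen s)
    (hf : ContinuousOn f s) : Measurable (s.indicator f) := by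
  classical
  rw [← piecewise_eq_indicator]
  exact hf.measurable_piecewise continuousOn_const hs.measurableSet

theorem IsPiecewiseExpanding.continuousOn_map (hT : IsPiecewiseExpanding Ω P T δ lam) :
    ContinuousOn T Ω := fun x hx => by
  rw [← hT.iUnion_piece, mem_iUnion] at hx
  obtain ⟨k, hk⟩ := hx
  exact (hT.hasFDerivAt hk).continuousAt.continuousWithinAt

theorem sum_abs_le_rowSumNorm (A : Matrix (Fin d) (Fin d) ℝ) (j : Fin d) {v : Fin d → ℝ}
    (hv : ‖v‖ ≤ 1) : ‖∑ i, A j i * v i‖ₑ ≤ rowSumNorm A := by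
  refine (enorm_sum_le _ _).trans (le_trans (Finset.sum_le_sum fun i _ => ?_)
    (le_iSup (fun a => ∑ b, ENNReal.ofReal |A a b|) j))
  rw [enorm_mul, ← ofReal_norm, Real.norm_eq_abs]
  refine mul_le_of_le_one_right' ?_
  rw [← ofReal_norm, ENNReal.ofReal_le_one]
  exact (norm_le_pi_norm v i).trans hv

end Regularity

/-! ### Boundary layers and the bound on the distortion away from them. -/

section Layers

variable {d : ℕ} {ι : Type*} {Ω : Set (Rn d)} {P : ι → Set (Rn d)} {T : Rn d → Rn d} {δ lam : ℝ}

theorem measurableSet_boundaryLayer {U : Set (Rn d)} (hU : IsOpen U) (ε : ℝ) :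
    MeasurableSet (boundaryLayer U ε) :=
  hU.measurableSet.inter (measurableSet_lt (Metric.continuous_infDist_pt _).measurable
    measurable_const)

/-- A point of an open set outside its boundary layer has a ball around it in the set. -/
theorem ball_subset_of_notMem_boundaryLayer {U : Set (Rn d)} (hU : IsOpen U) {x : Rn d}
    (hx : x ∈ U) {ε : ℝ}
    (hxε : x ∉ boundaryLayer U ε) : Metric.ball x ε ⊆ U := by
  have h1 : ε ≤ Metric.infDist x (frontier U) := by
    by_contra! h
    exact hxε ⟨hx, h⟩
  rcases (Metric.ball x ε).eq_empty_or_nonempty with h0 | h0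
  · rw [h0]
    exact empty_subset U
  -- A ball that misses the frontier is covered by the disjoint open sets `U` and the complement of
  -- its closure. Being connected and having its centre in `U`, it stays in `U`.
  refine Metric.isPreconnected_ball.subset_left_of_subset_union hU
    isClosed_closure.isOpen_compl (disjoint_compl_right.mono_left subset_closure) (fun y hy => ?_)
    ⟨x, Metric.mem_ball_self (Metric.nonempty_ball.1 h0), hx⟩
  by_contra h
  rw [mem_union, not_or, notMem_compl_iff] at h
  have h2 : y ∈ frontier U := ⟨h.2, fun h3 => h.1 (interior_subset h3)⟩
  have := Metric.infDist_le_dist_of_mem (x := x) h2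
  rw [Metric.mem_ball, dist_comm] at hy
  linarith

/-- A limit point lies in the `ε`-ball of some point of the set, hence in the piece; continuity of
the distance to the frontier keeps it out of the layer. -/
theorem IsPiecewiseExpanding.isCompact_diff_boundaryLayer
    (hT : IsPiecewiseExpanding Ω P T δ lam) (k : ι) {ε : ℝ} (hε : 0 < ε) :
    IsCompact (P k \ boundaryLayer (P k) ε) := by
  refine isCompact_Icc.of_isClosed_subset (isClosed_of_closure_subset fun x hx => ?_)
    (sdiff_subset.trans ((hT.piece_subset k).trans hT.subset_cube))
  obtain ⟨y, hy, hyx⟩ := Metric.mem_closure_iff.1 hx ε hε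
  have hxk : x ∈ P k := ball_subset_of_notMem_boundaryLayer (hT.piece_isOpen k) hy.1 hy.2 hyx
  refine ⟨hxk, fun h => ?_⟩
  obtain ⟨y, hy, hyx⟩ := Metric.mem_closure_iff.1 hx
    (ε - Metric.infDist x (frontier (P k))) (sub_pos.2 h.2)
  refine hy.2 ⟨hy.1, ?_⟩
  have := Metric.infDist_le_infDist_add_dist (s := frontier (P k)) (x := y) (y := x)
  rw [dist_comm] at this
  linarith

/-- A piece that is not all layer contains an `ε`-ball centred in the cube, hence a point of a fixed
finite `ε / 2`-net. Disjoint pieces contain different points. -/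
theorem IsPiecewiseExpanding.finite_diff_boundaryLayer
    (hT : IsPiecewiseExpanding Ω P T δ lam) {ε : ℝ} (hε : 0 < ε) :
    {k | (P k \ boundaryLayer (P k) ε).Nonempty}.Finite := by
  obtain ⟨t, ht, hcov⟩ := (isCompact_Icc (a := (0 : Rn d)) (b := 1)).elim_finite_subcover_image
    (b := Icc (0 : Rn d) 1) (c := fun c => Metric.ball c (ε / 2))
    (fun _ _ => Metric.isOpen_ball)
    fun x hx => mem_iUnion₂.2 ⟨x, hx, Metric.mem_ball_self (half_pos hε)⟩
  have h1 : ∀ k, (P k \ boundaryLayer (P k) ε).Nonempty → ∃ c ∈ t, c ∈ P k := by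
    rintro k ⟨x, hx⟩
    obtain ⟨c, hc, hxc⟩ := mem_iUnion₂.1 (hcov.2 (hT.subset_cube (hT.piece_subset k hx.1)))
    refine ⟨c, hc, ball_subset_of_notMem_boundaryLayer (hT.piece_isOpen k) hx.1 hx.2 ?_⟩
    rw [Metric.mem_ball, dist_comm] at hxc
    rw [Metric.mem_ball]
    linarith
  choose! c hc hck using h1
  refine Set.Finite.of_finite_image (f := c) (hcov.1.subset ?_) fun k hk l hl hkl => ?_
  · rintro _ ⟨k, hk, rfl⟩
    exact hc k hk
  · by_contra hne
    exact (hT.piece_disjoint hne).le_bot ⟨hck k hk, hkl ▸ hck l hl⟩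

/-- What remains of `Ω` lies in a finite union of compact sets on which the derivatives of `(DT)⁻¹`
are continuous. -/
theorem IsPiecewiseExpanding.exists_bound_off_layers (hT : IsPiecewiseExpanding Ω P T δ lam)
    {ε : ℝ} (hε : 0 < ε) : ∃ C, 0 ≤ C ∧ ∀ x ∈ Ω \ ⋃ k, boundaryLayer (P k) ε, ∀ j a b,
      |partialJacInv T j x a b| ≤ C := by
  set K := ⋃ k ∈ {k | (P k \ boundaryLayer (P k) ε).Nonempty}, (P k \ boundaryLayer (P k) ε)
  have hK : IsCompact K := (hT.finite_diff_boundaryLayer hε).isCompact_biUnion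
    fun k _ => hT.isCompact_diff_boundaryLayer k hε
  have hKΩ : K ⊆ Ω := iUnion₂_subset fun k _ => sdiff_subset.trans (hT.piece_subset k)
  have hsub : Ω \ ⋃ k, boundaryLayer (P k) ε ⊆ K := by
    rintro x ⟨hx, hx'⟩
    rw [← hT.iUnion_piece, mem_iUnion] at hx
    obtain ⟨k, hk⟩ := hx
    have : x ∈ P k \ boundaryLayer (P k) ε := ⟨hk, fun h => hx' (mem_iUnion_of_mem k h)⟩
    exact mem_iUnion₂.2 ⟨k, ⟨x, this⟩, this⟩
  have h1 : ∀ p : Fin d × Fin d × Fin d, ∃ C, ∀ x ∈ K, ‖partialJacInv T p.1 x p.2.1 p.2.2‖ ≤ C :=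
    fun p => hK.exists_bound_of_continuousOn ((hT.continuousOn_partialJacInv _ _ _).mono hKΩ)
  choose C hC using h1
  refine ⟨∑ p, |C p|, Finset.sum_nonneg fun _ _ => abs_nonneg _, fun x hx j a b => ?_⟩
  exact ((hC (j, a, b) x (hsub hx)).trans (le_abs_self _)).trans
    (Finset.single_le_sum (f := fun p => |C p|) (fun _ _ => abs_nonneg _) (Finset.mem_univ _))

theorem IsPiecewiseExpanding.exists_layer_small (hT : IsPiecewiseExpanding Ω P T δ lam) {η : ℝ}
    (hη : 0 < η) : ∃ ε, 0 < ε ∧ ∀ j x, ∑' k, ∫⁻ y in Icc (0 : ℝ) 1,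
      (boundaryLayer (P k) ε).indicator (fun z => rowSumNorm (partialJacInv T j z))
        (Function.update x j y) ≤ ENNReal.ofReal η := by
  have h1 : ∀ᶠ ε in 𝓝[>] (0 : ℝ), ∀ j, (⨆ x : Rn d, ∑' k, ∫⁻ y in Icc (0 : ℝ) 1,
      (boundaryLayer (P k) ε).indicator (fun z => rowSumNorm (partialJacInv T j z))
        (Function.update x j y)) ≤ ENNReal.ofReal η := by
    rw [eventually_all]
    exact fun j => (hT.layer_tendsto j).eventually_le_const (ENNReal.ofReal_pos.2 hη)
  obtain ⟨ε, h2, hε⟩ := (h1.and self_mem_nhdsWithin).exists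
  exact ⟨ε, hε, fun j x => (le_iSup _ x).trans (h2 j)⟩

variable [Countable ι]

/-- The integral along a line of a function that is supported in the boundary layers. -/
theorem IsPiecewiseExpanding.lintegral_layer_le (hT : IsPiecewiseExpanding Ω P T δ lam) {ε η : ℝ}
    {j : Fin d} {G : Rn d → ℝ} (hG0 : ∀ z ∉ ⋃ k, boundaryLayer (P k) ε, G z = 0)
    (hG : ∀ z ∈ Ω, ‖G z‖ₑ ≤ rowSumNorm (partialJacInv T j z)) {x : Rn d}
    (hx : ∑' k, ∫⁻ y in Icc (0 : ℝ) 1,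
      (boundaryLayer (P k) ε).indicator (fun z => rowSumNorm (partialJacInv T j z))
        (Function.update x j y) ≤ ENNReal.ofReal η) :
    ∫⁻ t, ‖G (Function.update x j t)‖ₑ ≤ ENNReal.ofReal η := by
  refine le_trans ?_ hx
  set V : ι → Set ℝ := fun k => {t | Function.update x j t ∈ boundaryLayer (P k) ε} with hV
  have hVm : ∀ k, MeasurableSet (V k) := fun k =>
    (continuous_update_line x j).measurable (measurableSet_boundaryLayer (hT.piece_isOpen k) ε)
  have hV1 : ∀ k, V k ⊆ Icc 0 1 := fun k t ht =>
    lineSlice_subset (hT.piece_subset_cube k) j x ht.1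
  rw [← setLIntegral_eq_of_support_subset (s := ⋃ k, V k)]
  · refine (lintegral_iUnion_le _ _).trans (ENNReal.tsum_le_tsum fun k => ?_)
    calc _ ≤ ∫⁻ t in V k, rowSumNorm (partialJacInv T j (Function.update x j t)) :=
          setLIntegral_mono' (hVm k) fun t ht => hG _ (hT.piece_subset k ht.1)
      _ = ∫⁻ t in Icc 0 1, (V k).indicator
            (fun t => rowSumNorm (partialJacInv T j (Function.update x j t))) t := by
          rw [lintegral_indicator (hVm k), Measure.restrict_restrict (hVm k),
            inter_eq_self_of_subset_left (hV1 k)]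
      _ = _ := rfl
  · intro t ht
    by_contra h
    refine ht ?_
    refine (congrArg _ (hG0 _ fun h' => ?_)).trans enorm_zero
    obtain ⟨k, hk⟩ := mem_iUnion.1 h'
    exact h (mem_iUnion.2 ⟨k, hk⟩)

end Layers

/-! ### Pulling back test fields, and the Lasota-Yorke inequality. -/

section TestFields

variable {d : ℕ} {ι : Type*} {Ω : Set (Rn d)} {P : ι → Set (Rn d)} {T : Rn d → Rn d} {δ lam : ℝ}
  {φ : Rn d → Rn d}

/-- The part of `∂_j ∑ i, [(DT)⁻¹]_{ji} (φ_i ∘ T)` in which the derivative falls on `(DT)⁻¹`. -/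
noncomputable def distortion (T : Rn d → Rn d) (φ : Rn d → Rn d) (j : Fin d) (z : Rn d) : ℝ :=
  ∑ i, partialJacInv T j z j i * φ (T z) i

/-- The part of `∂_j ∑ i, [(DT)⁻¹]_{ji} (φ_i ∘ T)` in which the derivative falls on `φ_i ∘ T`. -/
noncomputable def transport (T : Rn d → Rn d) (φ : Rn d → Rn d) (j : Fin d) (z : Rn d) : ℝ :=
  ∑ i, jacInv T z j i * ∑ k, jac T z k j * fderiv ℝ φ (T z) (Pi.single k 1) i

theorem fderiv_comp_single (z : Rn d) (i j : Fin d) :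
    fderiv ℝ φ (T z) (fderiv ℝ T z (Pi.single j 1)) i =
      ∑ k, jac T z k j * fderiv ℝ φ (T z) (Pi.single k 1) i := by
  have h1 : fderiv ℝ T z (Pi.single j 1) = ∑ k, jac T z k j • (Pi.single k 1 : Rn d) := by
    rw [pi_eq_sum_univ' (fderiv ℝ T z (Pi.single j 1))]
    refine Finset.sum_congr rfl fun k _ => ?_
    rw [jac_apply]
  rw [h1, map_sum, Finset.sum_apply]
  simp

theorem IsPiecewiseExpanding.hasDerivAt_pullback (hT : IsPiecewiseExpanding Ω P T δ lam)
    (hφ : ContDiff ℝ 1 φ) {z : Rn d} (hz : z ∈ Ω) (j : Fin d) :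
    HasDerivAt (fun t => ∑ i, jacInv T (Function.update z j t) j i *
      φ (T (Function.update z j t)) i) (distortion T φ j z + transport T φ j z) (z j) := by
  have h1 : HasFDerivAt T (fderiv ℝ T z) z := by
    rw [← hT.iUnion_piece, mem_iUnion] at hz
    obtain ⟨k, hk⟩ := hz
    exact hT.hasFDerivAt hk
  have h2 : HasFDerivAt (fun x => φ (T x)) ((fderiv ℝ φ (T z)).comp (fderiv ℝ T z)) z :=
    ((hφ.differentiable one_ne_zero) (T z)).hasFDerivAt.comp z h1
  have h3 : HasDerivAt (fun t => φ (T (Function.update z j t)))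
      (fderiv ℝ φ (T z) (fderiv ℝ T z (Pi.single j 1))) (z j) := by
    rw [← Function.update_eq_self j z] at h2
    have h4 := h2.comp_hasDerivAt (z j) (hasDerivAt_update z j (z j))
    rwa [Function.update_eq_self] at h4
  have h5 := HasDerivAt.fun_sum (u := Finset.univ) fun i _ =>
    (hT.hasDerivAt_jacInv hz j j i).1.mul (hasDerivAt_pi.1 h3 i)
  convert! h5 using 1
  simp only [distortion, transport, Function.update_eq_self, Finset.sum_add_distrib,
    fderiv_comp_single]

/-- Summing over `j` produces the product `DT (DT)⁻¹ = 1`, which leaves only the diagonal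
derivatives of `φ`. -/
theorem IsPiecewiseExpanding.sum_transport (hT : IsPiecewiseExpanding Ω P T δ lam) {z : Rn d}
    (hz : z ∈ Ω) : ∑ j, transport T φ j z = divergence φ (T z) := by
  have h1 : jac T z * jacInv T z = 1 :=
    Matrix.mul_nonsing_inv _ (isUnit_iff_ne_zero.2 (hT.det_jac_ne_zero hz))
  calc ∑ j, transport T φ j z
      = ∑ k, ∑ i, (jac T z * jacInv T z) k i * fderiv ℝ φ (T z) (Pi.single k 1) i := by
        simp only [transport, Matrix.mul_apply, Finset.mul_sum, Finset.sum_mul]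
        rw [Finset.sum_comm]
        conv_rhs => rw [Finset.sum_comm]
        refine Finset.sum_congr rfl fun i _ => ?_
        rw [Finset.sum_comm]
        exact Finset.sum_congr rfl fun k _ => Finset.sum_congr rfl fun j _ => by ring
    _ = divergence φ (T z) := by
        rw [h1]
        simp [divergence, Matrix.one_apply]

theorem exists_partial_bound (hφ : ContDiff ℝ 1 φ) (hc : HasCompactSupport φ) :
    ∃ C, 0 ≤ C ∧ ∀ x k i, |fderiv ℝ φ x (Pi.single k 1) i| ≤ C := by
  obtain ⟨C, hC⟩ := (hc.fderiv ℝ).exists_bound_of_continuous (hφ.continuous_fderiv one_ne_zero)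
  refine ⟨C, (norm_nonneg _).trans (hC 0), fun x k i => ?_⟩
  refine (norm_le_pi_norm (fderiv ℝ φ x (Pi.single k 1)) i).trans ?_
  refine ((fderiv ℝ φ x).le_opNorm _).trans ?_
  rw [Pi.norm_single, norm_one, mul_one]
  exact hC x

theorem continuous_partial_apply (hφ : ContDiff ℝ 1 φ) (k i : Fin d) :
    Continuous fun x => fderiv ℝ φ x (Pi.single k 1) i :=
  (continuous_apply i).comp ((hφ.continuous_fderiv one_ne_zero).clm_apply continuous_const)

theorem continuous_divergence (hφ : ContDiff ℝ 1 φ) : Continuous (divergence φ) :=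
  continuous_finsetSum _ fun i _ => continuous_partial_apply hφ i i

theorem exists_divergence_bound (hφ : ContDiff ℝ 1 φ) (hc : HasCompactSupport φ) :
    ∃ C, 0 ≤ C ∧ ∀ x, |divergence φ x| ≤ C := by
  obtain ⟨C, hC, h⟩ := exists_partial_bound hφ hc
  refine ⟨∑ _i : Fin d, C, Finset.sum_nonneg fun _ _ => hC, fun x => ?_⟩
  exact (Finset.abs_sum_le_sum_abs _ _).trans (Finset.sum_le_sum fun i _ => h x i i)

theorem IsPiecewiseExpanding.continuousOn_jacInv (hT : IsPiecewiseExpanding Ω P T δ lam)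
    (a b : Fin d) : ContinuousOn (fun x => jacInv T x a b) Ω := fun _ hx =>
  (hT.contDiffAt_jacInv hx a b).continuousAt.continuousWithinAt

theorem IsPiecewiseExpanding.continuousOn_jac (hT : IsPiecewiseExpanding Ω P T δ lam)
    (a b : Fin d) : ContinuousOn (fun x => jac T x a b) Ω := fun _ hx =>
  (hT.contDiffAt_jac hx a b).continuousAt.continuousWithinAt

theorem IsPiecewiseExpanding.continuousOn_distortion (hT : IsPiecewiseExpanding Ω P T δ lam)
    (hφ : ContDiff ℝ 1 φ) (j : Fin d) : ContinuousOn (distortion T φ j) Ω :=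
  continuousOn_finsetSum _ fun i _ => (hT.continuousOn_partialJacInv j j i).mul
    (((continuous_apply i).comp hφ.continuous).comp_continuousOn hT.continuousOn_map)

theorem IsPiecewiseExpanding.continuousOn_transport (hT : IsPiecewiseExpanding Ω P T δ lam)
    (hφ : ContDiff ℝ 1 φ) (j : Fin d) : ContinuousOn (transport T φ j) Ω :=
  continuousOn_finsetSum _ fun i _ => (hT.continuousOn_jacInv j i).mul
    (continuousOn_finsetSum _ fun k _ => (hT.continuousOn_jac k j).mul
      ((continuous_partial_apply hφ k i).comp_continuousOn hT.continuousOn_map))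

/-- Only the sum of the transports over `j` is controlled by `φ`. The glueing treats each direction
separately, so each transport must be integrable by itself; this is what the hypothesis on the
products is for. -/
theorem IsPiecewiseExpanding.integrableOn_transport (hT : IsPiecewiseExpanding Ω P T δ lam)
    (hφ : ContDiff ℝ 1 φ) (hc : HasCompactSupport φ) (j : Fin d) :
    IntegrableOn (transport T φ j) Ω := by
  obtain ⟨C, -, hC⟩ := exists_partial_bound hφ hc
  have h1 : transport T φ j = fun z => ∑ i, ∑ k, jac T z k j * jacInv T z j i *
      fderiv ℝ φ (T z) (Pi.single k 1) i := by
    funext z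
    simp only [transport, Finset.mul_sum]
    exact Finset.sum_congr rfl fun i _ => Finset.sum_congr rfl fun k _ => by ring
  rw [h1]
  refine integrable_finsetSum _ fun i _ => integrable_finsetSum _ fun k _ => ?_
  refine (hT.integrable_prod i j k).mul_bdd (c := C) ?_ (Eventually.of_forall fun z => hC _ _ _)
  exact (((continuous_partial_apply hφ k i).comp_continuousOn
    hT.continuousOn_map).aestronglyMeasurable hT.isOpen.measurableSet)

theorem abs_distortion_le (hφ1 : ∀ x, ‖φ x‖ ≤ 1) {j : Fin d} {z : Rn d} {C : ℝ}
    (hC : ∀ a b, |partialJacInv T j z a b| ≤ C) : |distortion T φ j z| ≤ d * C := by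
  refine (Finset.abs_sum_le_sum_abs _ _).trans ?_
  calc ∑ i, |partialJacInv T j z j i * φ (T z) i| ≤ ∑ _i : Fin d, C := by
        refine Finset.sum_le_sum fun i _ => ?_
        rw [abs_mul]
        exact (mul_le_of_le_one_right (abs_nonneg _)
          ((norm_le_pi_norm (φ (T z)) i).trans (hφ1 _))).trans (hC _ _)
    _ = d * C := by simp

/-- The pullback of `φ_j` on a piece has a continuous extension to the closure of the piece. -/
theorem IsPiecewiseExpanding.exists_pullback_extension (hT : IsPiecewiseExpanding Ω P T δ lam)
    (hφ : ContDiff ℝ 1 φ) (j : Fin d) (k : ι) : ∃ G : Rn d → ℝ, Measurable G ∧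
      ContinuousOn G (closure (P k)) ∧ ∀ z ∈ P k, G z = ∑ i, jacInv T z j i * φ (T z) i := by
  classical
  obtain ⟨gT, hgT, hgT'⟩ := hT.extend_map k
  obtain ⟨gJ, hgJ, hgJ'⟩ := hT.extend_jacInv k
  set g : Rn d → ℝ := fun z => ∑ i, gJ z j i * φ (gT z) i
  have hg : ContinuousOn g (closure (P k)) := continuousOn_finsetSum _ fun i _ =>
    ((continuous_apply_apply (ρ := fun _ _ : Fin d => ℝ) j i).comp_continuousOn hgJ).mul
      (((continuous_apply i).comp hφ.continuous).comp_continuousOn hgT)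
  refine ⟨(closure (P k)).indicator g, ?_, ?_, fun z hz => ?_⟩
  · rw [← piecewise_eq_indicator]
    exact hg.measurable_piecewise continuousOn_const isClosed_closure.measurableSet
  · exact hg.congr fun z hz => indicator_of_mem hz g
  · rw [indicator_of_mem (subset_closure hz)]
    simp only [g, hgT' hz, hgJ' hz]

variable [Countable ι]

/-- The divergence of a test field, pulled back by `T`, is up to a bounded error the weak divergence
of a field that is smaller by the factor `σ`. -/
theorem IsPiecewiseExpanding.exists_pulled_back_field (hT : IsPiecewiseExpanding Ω P T δ lam)
    {σ : ℝ} (hσ : lam⁻¹ < σ) : ∃ B, 0 ≤ B ∧ ∀ φ : Rn d → Rn d, ContDiff ℝ 1 φ →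
      HasCompactSupport φ → (∀ x, ‖φ x‖ ≤ 1) →
      ∃ (Θ : Fin d → Rn d → ℝ) (D R : Rn d → ℝ) (C : ℝ), (∀ j, Measurable (Θ j)) ∧
        (∀ j x, |Θ j x| ≤ σ) ∧ Measurable D ∧ (∀ x, |D x| ≤ C) ∧
        (∀ η : Rn d → ℝ, ContDiff ℝ 1 η → HasCompactSupport η →
          ∑ j, ∫ x, Θ j x * fderiv ℝ η x (Pi.single j 1) = -∫ x, D x * η x) ∧
        Measurable R ∧ (∀ x, |R x| ≤ B) ∧ ∀ x ∈ Ω, divergence φ (T x) = D x - R x := by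
  have hlam : 0 ≤ lam⁻¹ := inv_nonneg.2 (zero_le_one.trans hT.one_lt_lam.le)
  -- The layer width spends the whole margin `σ - λ⁻¹`. Both `ε` and the bound `K` are fixed before
  -- `φ`, which makes the error bound uniform in `φ`.
  obtain ⟨ε, hε, hlayer⟩ := hT.exists_layer_small (sub_pos.2 hσ)
  obtain ⟨K, hK0, hK⟩ := hT.exists_bound_off_layers hε
  have hB0 : 0 ≤ d * K + lam⁻¹ * δ⁻¹ :=
    add_nonneg (by positivity) (mul_nonneg hlam (inv_nonneg.2 hT.δ_pos.le))
  refine ⟨∑ _j : Fin d, (d * K + lam⁻¹ * δ⁻¹), Finset.sum_nonneg fun _ _ => hB0,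
    fun φ hφ hc hφ1 => ?_⟩
  set L : Set (Rn d) := ⋃ k, boundaryLayer (P k) ε with hL
  have hLm : MeasurableSet L := MeasurableSet.iUnion fun k =>
    measurableSet_boundaryLayer (hT.piece_isOpen k) ε
  have hLΩ : L ⊆ Ω := iUnion_subset fun k x hx => hT.piece_subset k hx.1
  set R : Fin d → Rn d → ℝ := fun j => Ω.indicator (distortion T φ j) with hR
  set V : Fin d → Rn d → ℝ := fun j => Ω.indicator (transport T φ j) with hV
  have hRm : ∀ j, Measurable (R j) := fun j =>
    measurable_indicator_of_continuousOn hT.isOpen (hT.continuousOn_distortion hφ j)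
  have hVm : ∀ j, Measurable (V j) := fun j =>
    measurable_indicator_of_continuousOn hT.isOpen (hT.continuousOn_transport hφ j)
  have hVi : ∀ j, Integrable (V j) := fun j =>
    (integrable_indicator_iff hT.isOpen.measurableSet).2 (hT.integrableOn_transport hφ hc j)
  -- The distortion splits into `N`, bounded and left in the error, and `G`, possibly unbounded but
  -- small in `L^1` on every line.
  set N : Fin d → Rn d → ℝ := fun j => Lᶜ.indicator (R j) with hN
  set G : Fin d → Rn d → ℝ := fun j => L.indicator (R j) with hG
  have hNm : ∀ j, Measurable (N j) := fun j => (hRm j).indicator hLm.compl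
  have hGm : ∀ j, Measurable (G j) := fun j => (hRm j).indicator hLm
  have hNG : ∀ j z, R j z = G j z + N j z := fun j z =>
    (congrFun (indicator_self_add_compl L (R j)) z).symm
  have hNb : ∀ j z, |N j z| ≤ Ω.indicator (fun _ => d * K) z := fun j z => by
    by_cases hz : z ∈ Ω
    · rw [indicator_of_mem hz]
      by_cases hzL : z ∈ L
      · simp only [hN, indicator_of_notMem (notMem_compl_iff.2 hzL), abs_zero]
        positivity
      · simp only [hN, hR, indicator_of_mem (mem_compl hzL), indicator_of_mem hz]
        exact abs_distortion_le hφ1 (hK z ⟨hz, hzL⟩ j)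
    · simp [hN, hR, indicator, hz]
  have hNb' : ∀ j z, |N j z| ≤ d * K := fun j z =>
    (hNb j z).trans (indicator_le_self' (fun _ _ => by positivity) z)
  have hΩfin : volume Ω ≠ ⊤ :=
    ((measure_mono hT.subset_cube).trans_lt isCompact_Icc.measure_lt_top).ne
  have hNi : ∀ j, Integrable (N j) := fun j =>
    (((integrable_indicator_iff hT.isOpen.measurableSet).2 (integrableOn_const hΩfin)).mono'
      (hNm j).aestronglyMeasurable (Eventually.of_forall (hNb j)))
  have hg : ∀ j, Integrable (G j) ∧ ∃ g : Rn d → ℝ, Measurable g ∧ (∀ z, |g z| ≤ σ - lam⁻¹) ∧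
      HasWeakPartial j g (G j) := fun j => by
    refine exists_line_primitive j (hGm j) (fun z hz => ?_) (sub_nonneg.2 hσ.le) fun x =>
      hT.lintegral_layer_le (fun z hz => indicator_of_notMem hz _) (fun z hz => ?_) (hlayer j x)
    · exact indicator_of_notMem (fun h => hz (hT.subset_cube (hLΩ h))) _
    · refine le_trans ?_ (sum_abs_le_rowSumNorm (partialJacInv T j z) j (hφ1 (T z)))
      change ‖L.indicator (R j) z‖ₑ ≤ ‖distortion T φ j z‖ₑ
      by_cases hzL : z ∈ L
      · simp only [hR, indicator_of_mem hzL, indicator_of_mem hz, le_refl]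
      · simp [indicator_of_notMem hzL]
  choose hGi g hgm hgb hgw using hg
  have hRi : ∀ j, Integrable (R j) := fun j =>
    ((hGi j).add (hNi j)).congr (Eventually.of_forall fun z => (hNG j z).symm)
  have hθ : ∀ j, ∃ θ S : Rn d → ℝ, Measurable θ ∧ Measurable S ∧ (∀ z, |θ z| ≤ lam⁻¹) ∧
      (∀ z, |S z| ≤ lam⁻¹ * δ⁻¹) ∧ HasWeakPartial j θ fun z => R j z + V j z + S z := fun j => by
    choose F hFm hFc hF using hT.exists_pullback_extension hφ j
    refine hT.exists_glued_extension j hFm hFc (fun k z hz => ?_) (fun k z hz => ?_)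
      ((hRm j).add (hVm j)) ((hRi j).add (hVi j)) fun z hz => ?_
    · rw [hF k z hz]
      exact sum_abs_le_rowSumNorm _ j (hφ1 _)
    · have hzΩ := hT.piece_subset k hz
      simp only [hR, hV, indicator_of_mem hzΩ]
      refine (hT.hasDerivAt_pullback hφ hzΩ j).congr_of_eventuallyEq ?_
      have h1 : ∀ᶠ t in 𝓝 (z j), Function.update z j t ∈ P k := by
        refine (continuous_update_line z j).continuousAt.eventually_mem ?_
        rw [Function.update_eq_self]
        exact (hT.piece_isOpen k).mem_nhds hz
      filter_upwards [h1] with t ht using hF k _ ht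
    · simp only [hR, hV, indicator_of_notMem hz, add_zero]
  choose θ S hθm hSm hθb hSb hθw using hθ
  -- Subtracting `G` removes the unbounded distortion, and the transports recombine into `div φ ∘
  -- T`. So `D` is bounded although the individual `V j` need not be.
  have hD : ∀ z, ∑ j, (R j z + V j z + S j z - G j z) =
      Ω.indicator (fun z => divergence φ (T z)) z + ∑ j, (N j z + S j z) := fun z => by
    have h1 : Ω.indicator (fun z => divergence φ (T z)) z = ∑ j, V j z := by
      by_cases hz : z ∈ Ω
      · simp only [hV, indicator_of_mem hz, hT.sum_transport hz]
      · simp only [hV, indicator_of_notMem hz, Finset.sum_const_zero]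
    rw [h1, ← Finset.sum_add_distrib]
    exact Finset.sum_congr rfl fun j _ => by rw [hNG]; ring
  have hNS : ∀ z, |∑ j, (N j z + S j z)| ≤ ∑ _j : Fin d, (d * K + lam⁻¹ * δ⁻¹) := fun z =>
    (Finset.abs_sum_le_sum_abs _ _).trans (Finset.sum_le_sum fun j _ =>
      (abs_add_le _ _).trans (add_le_add (hNb' j z) (hSb j z)))
  obtain ⟨C, hC0, hC⟩ := exists_divergence_bound hφ hc
  refine ⟨fun j z => θ j z - g j z, fun z => ∑ j, (R j z + V j z + S j z - G j z),
    fun z => ∑ j, (N j z + S j z), C + ∑ _j : Fin d, (d * K + lam⁻¹ * δ⁻¹),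
    fun j => (hθm j).sub (hgm j), fun j z => ?_, ?_, fun z => ?_, fun η hη hηc => ?_, ?_, hNS,
    fun z hz => ?_⟩
  · have := (abs_sub (θ j z) (g j z)).trans (add_le_add (hθb j z) (hgb j z))
    linarith
  · exact Finset.measurable_sum _ fun j _ =>
      (((hRm j).add (hVm j)).add (hSm j)).sub (hGm j)
  · simp only [hD]
    refine (abs_add_le _ _).trans (add_le_add ?_ (hNS z))
    by_cases hz : z ∈ Ω
    · rw [indicator_of_mem hz]
      exact hC _
    · rw [indicator_of_notMem hz, abs_zero]
      exact hC0
  · have hloc : ∀ j, LocallyIntegrable fun z => R j z + V j z + S j z := fun j =>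
      ((hRi j).add (hVi j)).locallyIntegrable.add (locallyIntegrable_of_bdd (hSm j) (hSb j))
    have hlocG : ∀ j, LocallyIntegrable (G j) := fun j => (hGi j).locallyIntegrable
    have hw : ∀ j, HasWeakPartial j (fun z => θ j z - g j z)
        fun z => R j z + V j z + S j z - G j z := fun j =>
      (hθw j).sub (hgw j) (C := σ) (hθm j) (hgm j) (fun z => (hθb j z).trans hσ.le)
        (fun z => (hgb j z).trans (by linarith)) (hloc j) (hlocG j)
    rw [Finset.sum_congr rfl fun j _ => hw j η hη hηc, Finset.sum_neg_distrib,
      ← integral_finsetSum]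
    · simp only [Finset.sum_mul]
    · intro j _
      simpa only [smul_eq_mul, mul_comm, Pi.sub_apply] using ((hloc j).sub
        (hlocG j)).integrable_smul_right_of_hasCompactSupport hη.continuous hηc
  · exact Finset.measurable_sum _ fun j _ => (hNm j).add (hSm j)
  · simp only [hD, indicator_of_mem hz, add_sub_cancel_right]

/-- The one-step Lasota-Yorke inequality. -/
theorem IsPiecewiseExpanding.exists_bvNorm_transfer_le (hT : IsPiecewiseExpanding Ω P T δ lam)
    {σ : ℝ} (hσ : lam⁻¹ < σ) : ∃ B, 0 ≤ B ∧ ∀ h : Rn d → ℝ, IntegrableOn h Ω →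
      bvNorm Ω (transfer Ω T h) ≤ ENNReal.ofReal σ * bvNorm Ω h +
        ENNReal.ofReal B * eLpNorm h 1 (volume.restrict Ω) := by
  have hσ0 : 0 < σ := (inv_pos.2 (zero_lt_one.trans hT.one_lt_lam)).trans hσ
  obtain ⟨B, hB, hfield⟩ := hT.exists_pulled_back_field hσ
  refine ⟨B, hB, fun h hh => iSup₂_le fun φ hφ => ?_⟩
  obtain ⟨Θ, D, R, C, hΘm, hΘ, hDm, hD, hw, hRm, hR, hdiv⟩ := hfield φ hφ.1 hφ.2.1 hφ.2.2
  obtain ⟨K, -, hK⟩ := exists_divergence_bound hφ.1 hφ.2.1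
  have hi : Integrable (Ω.indicator h) := (integrable_indicator_iff hT.isOpen.measurableSet).2 hh
  have h0 : ∀ x ∉ Icc (0 : Rn d) 1, Ω.indicator h x = 0 := fun x hx =>
    indicator_of_notMem (fun h' => hx (hT.subset_cube h')) h
  have h1 : Ω.indicator (transfer Ω T h) = transfer Ω T h := by
    rw [transfer, indicator_indicator, inter_self]
  have h2 : ∫ x, Ω.indicator (transfer Ω T h) x * divergence φ x =
      (∫ x, Ω.indicator h x * D x) - ∫ x, Ω.indicator h x * R x := by
    rw [h1, hT.integral_transfer_mul hh (continuous_divergence hφ.1).measurable hK,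
      ← integral_sub (hi.mul_bdd hDm.aestronglyMeasurable (Eventually.of_forall hD))
        (hi.mul_bdd hRm.aestronglyMeasurable (Eventually.of_forall hR)),
      ← integral_indicator hT.isOpen.measurableSet]
    refine integral_congr_ae (Eventually.of_forall fun x => ?_)
    by_cases hx : x ∈ Ω
    · simp only [indicator_of_mem hx, hdiv x hx]
      ring
    · simp [indicator_of_notMem hx]
  have h3 : ‖∫ x, Ω.indicator h x * R x‖ₑ ≤
      ENNReal.ofReal B * eLpNorm h 1 (volume.restrict Ω) := by
    refine (enorm_integral_le_lintegral_enorm _).trans ?_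
    rw [eLpNorm_one_eq_lintegral_enorm, ← lintegral_indicator hT.isOpen.measurableSet,
      ← lintegral_const_mul' _ _ ENNReal.ofReal_ne_top]
    refine lintegral_mono fun x => ?_
    rw [enorm_mul, mul_comm, enorm_indicator_eq_indicator_enorm, ← ofReal_norm (R x)]
    gcongr
    exact hR x
  rw [h2]
  calc _ ≤ ENNReal.ofReal (∫ x, Ω.indicator h x * D x) + ‖∫ x, Ω.indicator h x * R x‖ₑ := by
        rw [← ofReal_norm, Real.norm_eq_abs]
        refine (ENNReal.ofReal_le_ofReal ?_).trans ENNReal.ofReal_add_le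
        have := neg_abs_le (∫ x, Ω.indicator h x * R x)
        linarith
    _ ≤ _ := add_le_add (integral_mul_weakDivergence_le hi h0 hσ0 hΘm hΘ hDm hD hw) h3

theorem IsPiecewiseExpanding.exists_bvNorm_iterate_le (hT : IsPiecewiseExpanding Ω P T δ lam)
    {σ : ℝ} (hσ : lam⁻¹ < σ) (hσ1 : σ < 1) : ∃ B, 0 < B ∧ ∀ (n : ℕ) (h : Rn d → ℝ),
      IntegrableOn h Ω → bvNorm Ω ((transfer Ω T)^[n] h) ≤
        ENNReal.ofReal (σ ^ n) * bvNorm Ω h +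
          ENNReal.ofReal B * eLpNorm h 1 (volume.restrict Ω) := by
  have hσ0 : 0 < σ := (inv_pos.2 (zero_lt_one.trans hT.one_lt_lam)).trans hσ
  obtain ⟨B₀, hB₀, hstep⟩ := hT.exists_bvNorm_transfer_le hσ
  have h1 : 0 < 1 - σ := sub_pos.2 hσ1
  -- The constant need only satisfy `σ B + B₀ ≤ B`, so that the errors of successive steps sum
  -- geometrically; the added `1` makes it positive even if `B₀ = 0`.
  have hB : 0 < (B₀ + 1) / (1 - σ) := by positivity
  have hB' : σ * ((B₀ + 1) / (1 - σ)) + B₀ ≤ (B₀ + 1) / (1 - σ) := by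
    have : (1 - σ) * ((B₀ + 1) / (1 - σ)) = B₀ + 1 := mul_div_cancel₀ _ h1.ne'
    linarith
  refine ⟨(B₀ + 1) / (1 - σ), hB, fun n h hh => ?_⟩
  generalize (B₀ + 1) / (1 - σ) = B at *
  induction n with
  | zero => simp
  | succ n ih =>
    have h2 := hT.iterate_transfer hh n
    rw [Function.iterate_succ_apply']
    calc _ ≤ ENNReal.ofReal σ * bvNorm Ω ((transfer Ω T)^[n] h) +
          ENNReal.ofReal B₀ * eLpNorm ((transfer Ω T)^[n] h) 1 (volume.restrict Ω) :=
          hstep _ h2.1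
      _ ≤ ENNReal.ofReal σ * (ENNReal.ofReal (σ ^ n) * bvNorm Ω h +
            ENNReal.ofReal B * eLpNorm h 1 (volume.restrict Ω)) +
          ENNReal.ofReal B₀ * eLpNorm h 1 (volume.restrict Ω) := by
          gcongr
          exact h2.2
      _ = ENNReal.ofReal (σ ^ (n + 1)) * bvNorm Ω h +
          ENNReal.ofReal (σ * B + B₀) * eLpNorm h 1 (volume.restrict Ω) := by
          rw [ENNReal.ofReal_add (mul_nonneg hσ0.le hB.le) hB₀, ENNReal.ofReal_mul hσ0.le,
            pow_succ' σ n, ENNReal.ofReal_mul hσ0.le]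
          ring
      _ ≤ _ := by gcongr

end TestFields

theorem lemma3p1 {d : ℕ} (hd : 1 ≤ d) {ι : Type*} [Countable ι] {Ω : Set (Rn d)}
    {P : ι → Set (Rn d)} {T : Rn d → Rn d} {δ lam : ℝ}
    (hT : IsPiecewiseExpanding Ω P T δ lam) :
    -- the series defining `L h` converges almost everywhere, and `L` is an `L^1` contraction
    (∀ h : Rn d → ℝ, IntegrableOn h Ω →
      (∀ᵐ x ∂(volume.restrict Ω), Summable (transferTerm Ω T h x)) ∧
      ∀ n : ℕ, IntegrableOn ((transfer Ω T)^[n] h) Ω ∧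
        eLpNorm ((transfer Ω T)^[n] h) 1 (volume.restrict Ω) ≤
          eLpNorm h 1 (volume.restrict Ω)) ∧
    -- the Lasota-Yorke inequality
    ∀ σ : ℝ, lam⁻¹ < σ → σ < 1 → ∃ B : ℝ, 0 < B ∧ ∀ (n : ℕ) (h : Rn d → ℝ), MemBV Ω h →
      MemBV Ω ((transfer Ω T)^[n] h) ∧
      bvNorm Ω ((transfer Ω T)^[n] h) ≤
        ENNReal.ofReal (σ ^ n) * bvNorm Ω h +
          ENNReal.ofReal B * eLpNorm h 1 (volume.restrict Ω) := by
  refine ⟨fun h hh => ⟨?_, hT.iterate_transfer hh⟩, fun σ hσ hσ1 => ?_⟩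
  · filter_upwards [ae_restrict_of_ae (hT.ae_summable_pieceTransfer hh)] with x hx
    exact (hT.transferTerm_reindex h x).1.2 hx
  · obtain ⟨B, hB, hLY⟩ := hT.exists_bvNorm_iterate_le hσ hσ1
    -- The inequality was proved for every integrable function, with no assumption that the
    -- variation of an iterate is finite; membership in `BV` is thus read off from its finite
    -- right-hand side.
    refine ⟨B, hB, fun n h hh => ⟨⟨(hT.iterate_transfer hh.1 n).1, ?_⟩, hLY n h hh.1⟩⟩
    refine (hLY n h hh.1).trans_lt (ENNReal.add_lt_top.2
      ⟨ENNReal.mul_lt_top ENNReal.ofReal_lt_top hh.2, ENNReal.mul_lt_top ENNReal.ofReal_lt_top ?_⟩)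
    rw [eLpNorm_one_eq_lintegral_enorm]
    exact hh.1.2
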